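/- **Setting.** Let $X$ be a locally compact Hausdorff space with countable base, $\mathcal V$ a base of its topology consisting of relatively compact open sets and, for every $V\in\mathcal V$, let $H_V$ be a boundary kernel for $V$, that is, a kernel on $X$ with its Borel sets such that $H_V(x,X\setminus\partial V)=0$ for $x\in V$ and $H_V(x,\cdot)=\varepsilon_x$ (Dirac measure at $x$) for $x\notin V$. Write $H_Vf(x)=\int f\,dH_V(x,\cdot)$ and, for open $U$, $\mathcal V(U)=\{W\in\mathcal V:\overline W\subset U\}$. A lower semicontinuous $u:U\to\,]-\infty,\infty]$ is *hyperharmonic* on $U$ if $H_Wu(x)\le u(x)$ for all $x\in W\in\mathcal V(U)$; if this is only required for $x\in U$, $W\in\mathcal W(x)$, where each $\mathcal W(x)$, $x\in U$, is a fundamental system of neighborhoods of $x$ from $\mathcal V(U)$ (a *local choice* $\mathcal W$ from $\mathcal V$ in $U$), then $u$ is *$\mathcal W$-hyperharmonic*. A continuous real function $h$ on $U$ is *harmonic* on $U$ if $H_Vh=h$ for all $V\in\mathcal V(U)$. A hyperharmonic function $s$ on $U$ is *superharmonic* if, for every $V\in\mathcal V(U)$, $H_Vs$ is locally bounded on $V$.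 Suppose that $(H_V)_{V\in\mathcal V}$ is a *normal Bauer family of harmonic boundary kernels*, that is, for every $V\in\mathcal V$: (1) $H_WH_V=H_V$ for all $W\in\mathcal V$ with $W\subset V$; (2) $H_Vf$ is continuous on $X$ for every continuous $f:X\to\mathbb R$, and $H_V1=1$; (3) for some local choice $\mathcal W$ from $\mathcal V$ in $V$, the $\mathcal W$-hyperharmonic functions $u\ge 0$ on $V$ separate the points of $V$; (4) $H_Vf$ is continuous on $V$ for every bounded Borel function $f$ on $X$. Suppose moreover that it is *elliptic*: every harmonic function $h\ge0$ on a connected open set $U$ is identically zero or strictly positive on $U$. An open set $W$ is a *$\mathcal P$-set* if the hyperharmonic functions $u\ge0$ on $W$ separate the points of $W$. A compact $K$ contained in a $\mathcal P$-set is *stable* if, for every $z\in\partial K$, there are an open neighborhood $W'$ of $z$ and a strictly positive superharmonic function $s$ on $W'\setminus K$ with $\lim_{x\to z}s(x)=0$. A compact $K\ne\emptyset$ is *strongly stable* if it is contained in a $\mathcal P$-set $W'$ for which there is a strictly positive harmonic function on $W'\setminus K$ which tends to zero at $\partial K$. **Proposition.** Let $L$ be a compact subset of a $\mathcal P$-set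 $W$. Then there exists a stable compact neighborhood $K$ of $L$ with $K\subset W$. Moreover, $K$ can be chosen to be a finite union of strongly stable compact sets contained in $W$, each of which is a neighborhood of a point of $L$. -/

import Mathlib

open Set Filter Topology MeasureTheory ProbabilityTheory

namespace BauerFamily

variable {X : Type*} [TopologicalSpace X] [MeasurableSpace X]

/-- `𝒱(U)`: the members of `𝒱` whose closure is contained in `U`. -/
def inside (𝒱 : Set (Set X)) (U : Set X) : Set (Set X) :=
  {W | W ∈ 𝒱 ∧ closure W ⊆ U}

/-- The kernel `T` is a boundary kernel for `U`: for `x ∈ U` the measure `T(x, ·)` does not charge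
the complement of `∂U`, and for `x ∉ U` it is the Dirac measure at `x`. -/
def IsBoundaryKernel (T : Kernel X X) (U : Set X) : Prop :=
  (∀ x ∈ U, T x (frontier U)ᶜ = 0) ∧ ∀ x ∉ U, T x = Measure.dirac x

/-- The integral `∫ u dμ ∈ [-∞, ∞]` of a numerical function, as the integral of the positive part
minus the integral of the negative part. It is only used when the negative part has a finite
integral: there `u` is lower semicontinuous and `> -∞` on an open set `U`, and `μ = H_W(x, ·)` is a
probability measure carried by the compact set `∂W ⊆ U`. -/
noncomputable def eintegral (μ : Measure X) (u : X → EReal) : EReal :=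
  ((∫⁻ y, (u y).toENNReal ∂μ : ENNReal) : EReal) -
    ((∫⁻ y, (-u y).toENNReal ∂μ : ENNReal) : EReal)

/-- A local choice from `𝒱` in `U`: for every `x ∈ U`, `𝒲 x` is a fundamental system of
neighborhoods of `x` consisting of members of `𝒱(U)`. -/
def IsLocalChoice (𝒱 : Set (Set X)) (U : Set X) (𝒲 : X → Set (Set X)) : Prop :=
  ∀ x ∈ U, (∀ W ∈ 𝒲 x, W ∈ inside 𝒱 U ∧ W ∈ 𝓝 x) ∧ ∀ N ∈ 𝓝 x, ∃ W ∈ 𝒲 x, W ⊆ N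

/-- `u` (only its values on `U` matter) is `𝒲`-hyperharmonic on `U`: it is lower semicontinuous
on `U` with values in `]-∞, ∞]`, and `H_W u(x) ≤ u(x)` for `x ∈ U` and `W ∈ 𝒲 x`. -/
def IsHyperharmonicFor (H : Set X → Kernel X X) (𝒲 : X → Set (Set X)) (U : Set X)
    (u : X → EReal) : Prop :=
  LowerSemicontinuousOn u U ∧ (∀ x ∈ U, u x ≠ ⊥) ∧
    ∀ x ∈ U, ∀ W ∈ 𝒲 x, eintegral (H W x) u ≤ u x

/-- `u` is hyperharmonic on `U`: the preceding notion for the family of all `W ∈ 𝒱(U)` that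
contain `x`. -/
def IsHyperharmonic (𝒱 : Set (Set X)) (H : Set X → Kernel X X) (U : Set X) (u : X → EReal) :
    Prop :=
  IsHyperharmonicFor H (fun x => {W | W ∈ inside 𝒱 U ∧ x ∈ W}) U u

/-- `h` (only its values on `U` matter) is harmonic on `U`: it is real and continuous on `U`, and
`H_V h = h` for all `V ∈ 𝒱(U)`. (At points outside `V` the last equality holds trivially.) -/
def IsHarmonic (𝒱 : Set (Set X)) (H : Set X → Kernel X X) (U : Set X) (h : X → ℝ) : Prop :=
  ContinuousOn h U ∧ ∀ V ∈ inside 𝒱 U, ∀ x ∈ V, ∫ y, h y ∂(H V x) = h x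

/-- `s` is superharmonic on `U`: it is hyperharmonic on `U`, and, for every `V ∈ 𝒱(U)`,
the function `H_V s` is locally bounded on `V`. -/
def IsSuperharmonic (𝒱 : Set (Set X)) (H : Set X → Kernel X X) (U : Set X) (s : X → EReal) :
    Prop :=
  IsHyperharmonic 𝒱 H U s ∧
    ∀ V ∈ inside 𝒱 U, ∀ x ∈ V, ∃ C : ℝ, ∀ᶠ y in 𝓝[V] x,
      ((-C : ℝ) : EReal) ≤ eintegral (H V y) s ∧ eintegral (H V y) s ≤ ((C : ℝ) : EReal)

/-- `(H_V)`, `V ∈ 𝒱`, is a normal Bauer family of harmonic boundary kernels on `X`.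
The values of `H` at sets outside `𝒱` are irrelevant. -/
structure IsNormalBauerFamily (𝒱 : Set (Set X)) (H : Set X → Kernel X X) : Prop where
  /-- `𝒱` is a base for the topology -/
  isBasis : TopologicalSpace.IsTopologicalBasis 𝒱
  /-- consisting of relatively compact (open) sets. -/
  isCompact_closure : ∀ V ∈ 𝒱, IsCompact (closure V)
  isBoundaryKernel : ∀ V ∈ 𝒱, IsBoundaryKernel (H V) V
  /-- `H_W H_V = H_V` whenever `W ⊆ V`, where `(S T)(x, ·) = ∫ T(y, ·) S(x, dy)`. -/
  comp_eq : ∀ V ∈ 𝒱, ∀ W ∈ 𝒱, W ⊆ V → (H V) ∘ₖ (H W) = H V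
  /-- `H_V f` is continuous on `X` for every continuous real function `f` on `X`. -/
  continuous_apply : ∀ V ∈ 𝒱, ∀ f : X → ℝ, Continuous f →
    Continuous fun x => ∫ y, f y ∂(H V x)
  /-- `H_V 1 = 1`. -/
  apply_univ : ∀ V ∈ 𝒱, ∀ x, H V x univ = 1
  /-- For some local choice `𝒲` from `𝒱` in `V`, the positive `𝒲`-hyperharmonic functions on `V`
  separate the points of `V`. -/
  separates : ∀ V ∈ 𝒱, ∃ 𝒲 : X → Set (Set X), IsLocalChoice 𝒱 V 𝒲 ∧
    ∀ x ∈ V, ∀ y ∈ V, x ≠ y →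
      ∃ u : X → EReal, IsHyperharmonicFor H 𝒲 V u ∧ (∀ z ∈ V, 0 ≤ u z) ∧ u x ≠ u y
  /-- `H_V f` is continuous on `V` for every bounded Borel function `f` on `X`. -/
  continuousOn_apply : ∀ V ∈ 𝒱, ∀ f : X → ℝ, Measurable f → (∃ C : ℝ, ∀ x, |f x| ≤ C) →
    ContinuousOn (fun x => ∫ y, f y ∂(H V x)) V

/-- The family is elliptic: every harmonic function `h ≥ 0` on a connected open set is identically
zero or strictly positive. -/
def IsElliptic (𝒱 : Set (Set X)) (H : Set X → Kernel X X) : Prop :=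
  ∀ U : Set X, IsOpen U → IsConnected U → ∀ h : X → ℝ, IsHarmonic 𝒱 H U h →
    (∀ x ∈ U, 0 ≤ h x) → (∀ x ∈ U, h x = 0) ∨ ∀ x ∈ U, 0 < h x

/-- A `𝒫`-set: an open set `U` such that the positive hyperharmonic functions on `U` separate the
points of `U`. -/
def IsPSet (𝒱 : Set (Set X)) (H : Set X → Kernel X X) (U : Set X) : Prop :=
  IsOpen U ∧ ∀ x ∈ U, ∀ y ∈ U, x ≠ y →
    ∃ u : X → EReal, IsHyperharmonic 𝒱 H U u ∧ (∀ z ∈ U, 0 ≤ u z) ∧ u x ≠ u y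

/-- `K` is a stable compact: it is compact, contained in a `𝒫`-set, and for every `z ∈ ∂K` there
are an open neighborhood `W` of `z` and a strictly positive superharmonic function `s` on `W \ K`
such that `s(x) → 0` as `x → z`. -/
def IsStable (𝒱 : Set (Set X)) (H : Set X → Kernel X X) (K : Set X) : Prop :=
  IsCompact K ∧ (∃ W, IsPSet 𝒱 H W ∧ K ⊆ W) ∧
    ∀ z ∈ frontier K, ∃ W : Set X, IsOpen W ∧ z ∈ W ∧ ∃ s : X → EReal,
      IsSuperharmonic 𝒱 H (W \ K) s ∧ (∀ x ∈ W \ K, 0 < s x) ∧ Tendsto s (𝓝[W \ K] z) (𝓝 0)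

/-- `K` is a strongly stable compact: it is compact, non-empty, and contained in a `𝒫`-set `W` for
which there is a strictly positive harmonic function on `W \ K` that tends to zero at `∂K`. -/
def IsStronglyStable (𝒱 : Set (Set X)) (H : Set X → Kernel X X) (K : Set X) : Prop :=
  IsCompact K ∧ K.Nonempty ∧ ∃ W, IsPSet 𝒱 H W ∧ K ⊆ W ∧ ∃ h : X → ℝ,
    IsHarmonic 𝒱 H (W \ K) h ∧ (∀ x ∈ W \ K, 0 < h x) ∧
      ∀ z ∈ frontier K, Tendsto h (𝓝[W \ K] z) (𝓝 0)

end BauerFamily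

/-!
A nonempty compact set that carries harmonic measures of arbitrarily small neighborhoods of each
of its points cannot lie in a `𝒫`-set. This makes the components of open subsets of a `𝒫`-set open
and, with ellipticity, gives a strong maximum principle on connected `𝒫`-sets; let `W` be one of
them. Given `x ∈ W`, take `V ∋ x` in `𝒱(W)`, the component `G` of `x` in `V`, and a continuous
bump `0 ≤ φ ≤ 1` with `φ(x) = 1`, supported in a compact `C ⊆ G`. Let `w` be the least supermean
function above `φ`. The function `p = w - H_V w` vanishes off `V`, is harmonic on `V \ C`, and is
strictly positive on `G`: otherwise it would vanish on `G`, so `w` would be harmonic on all of `W`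
and, by the maximum principle, equal to `1`; then every positive bounded supermean function would
attain its minimum in `C` and thus be constant, although these functions separate points. Hence,
for `0 < c < min_C p`, the compact set `{p ≥ c}` is a neighborhood of `x` with `c - p` strictly
positive and harmonic outside it and zero on its boundary. Finitely many such sets cover `L`.
-/

namespace BauerFamily

/-- The bounded Borel functions, on which every kernel `H_V` acts. -/
def IsBoundedBorel {X : Type*} [MeasurableSpace X] (f : X → ℝ) : Prop :=
  Measurable f ∧ ∃ C : ℝ, ∀ x, |f x| ≤ C

section BoundedBorel

variable {X : Type*} [MeasurableSpace X] {f g : X → ℝ}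

lemma IsBoundedBorel.integrable (hf : IsBoundedBorel f) (μ : Measure X) [IsFiniteMeasure μ] :
    Integrable f μ := by
  obtain ⟨hm, C, hC⟩ := hf
  exact .of_bound hm.aestronglyMeasurable C (.of_forall hC)

lemma isBoundedBorel_of_mem_Icc {a b : ℝ} (hf : Measurable f) (h : ∀ x, f x ∈ Icc a b) :
    IsBoundedBorel f :=
  ⟨hf, max |a| |b|, fun x => abs_le_max_abs_abs (h x).1 (h x).2⟩

lemma isBoundedBorel_indicator_one {A : Set X} (hA : MeasurableSet A) :
    IsBoundedBorel (A.indicator (1 : X → ℝ)) :=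
  isBoundedBorel_of_mem_Icc (measurable_one.indicator hA) fun x =>
    ⟨indicator_nonneg (fun _ _ => zero_le_one) x, indicator_le_self' (fun _ _ => zero_le_one) x⟩

lemma IsBoundedBorel.neg (hf : IsBoundedBorel f) : IsBoundedBorel (-f) :=
  ⟨hf.1.neg, by simpa only [Pi.neg_apply, abs_neg] using hf.2⟩

lemma IsBoundedBorel.sub (hf : IsBoundedBorel f) (hg : IsBoundedBorel g) :
    IsBoundedBorel (f - g) := by
  obtain ⟨hfm, C, hC⟩ := hf
  obtain ⟨hgm, D, hD⟩ := hg
  exact ⟨hfm.sub hgm, C + D, fun x => (abs_sub _ _).trans (add_le_add (hC x) (hD x))⟩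

lemma IsBoundedBorel.integral_kernel (hf : IsBoundedBorel f) (T : Kernel X X) [IsMarkovKernel T] :
    IsBoundedBorel fun x => ∫ y, f y ∂(T x) := by
  obtain ⟨hm, C, hC⟩ := hf
  refine ⟨hm.stronglyMeasurable.integral_kernel.measurable, C, fun x => ?_⟩
  simpa using norm_integral_le_of_norm_le_const (μ := T x) (f := f) (.of_forall hC)

lemma ae_eq_const_of_le_integral {μ : Measure X} [IsProbabilityMeasure μ] {m : ℝ}
    (hf : Integrable f μ) (hfm : ∀ᵐ x ∂μ, f x ≤ m) (hm : m ≤ ∫ x, f x ∂μ) :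
    ∀ᵐ x ∂μ, f x = m := by
  have hint : ∫ x, f x ∂μ = ∫ _, m ∂μ :=
    le_antisymm (integral_mono_ae hf (integrable_const m) hfm) (by simpa using hm)
  exact (integral_eq_iff_of_ae_le hf (integrable_const m) hfm).1 hint

end BoundedBorel

/-- The conditions (1), (2) and (4) of a normal Bauer family of harmonic boundary kernels, without
the local separation property (3). -/
structure IsNormalHarmonicFamily {X : Type*} [TopologicalSpace X] [MeasurableSpace X]
    (𝒱 : Set (Set X)) (H : Set X → Kernel X X) : Prop where
  isBasis : TopologicalSpace.IsTopologicalBasis 𝒱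
  isCompact_closure : ∀ V ∈ 𝒱, IsCompact (closure V)
  isBoundaryKernel : ∀ V ∈ 𝒱, IsBoundaryKernel (H V) V
  comp_eq : ∀ V ∈ 𝒱, ∀ W ∈ 𝒱, W ⊆ V → (H V) ∘ₖ (H W) = H V
  continuous_apply : ∀ V ∈ 𝒱, ∀ f : X → ℝ, Continuous f →
    Continuous fun x => ∫ y, f y ∂(H V x)
  apply_univ : ∀ V ∈ 𝒱, ∀ x, H V x univ = 1
  continuousOn_apply : ∀ V ∈ 𝒱, ∀ f : X → ℝ, IsBoundedBorel f →
    ContinuousOn (fun x => ∫ y, f y ∂(H V x)) V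

section Kernels

variable {X : Type*} [TopologicalSpace X] [MeasurableSpace X] {𝒱 : Set (Set X)}
  {H : Set X → Kernel X X} {U V : Set X} {f h : X → ℝ} {x : X}

lemma IsNormalBauerFamily.isNormalHarmonicFamily (hH : IsNormalBauerFamily 𝒱 H) :
    IsNormalHarmonicFamily 𝒱 H where
  isBasis := hH.isBasis
  isCompact_closure := hH.isCompact_closure
  isBoundaryKernel := hH.isBoundaryKernel
  comp_eq := hH.comp_eq
  continuous_apply := hH.continuous_apply
  apply_univ := hH.apply_univ
  continuousOn_apply V hV f hf := hH.continuousOn_apply V hV f hf.1 hf.2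

namespace IsNormalHarmonicFamily

lemma isMarkovKernel (hH : IsNormalHarmonicFamily 𝒱 H) (hV : V ∈ 𝒱) : IsMarkovKernel (H V) :=
  ⟨fun x => ⟨hH.apply_univ V hV x⟩⟩

lemma isOpen (hH : IsNormalHarmonicFamily 𝒱 H) (hV : V ∈ 𝒱) : IsOpen V :=
  hH.isBasis.isOpen hV

lemma ae_mem_frontier (hH : IsNormalHarmonicFamily 𝒱 H) (hV : V ∈ 𝒱) (hx : x ∈ V) :
    ∀ᵐ y ∂(H V x), y ∈ frontier V :=
  ae_iff.2 ((hH.isBoundaryKernel V hV).1 x hx)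

lemma ae_mem_closure (hH : IsNormalHarmonicFamily 𝒱 H) (hV : V ∈ 𝒱) (hx : x ∈ V) :
    ∀ᵐ y ∂(H V x), y ∈ closure V :=
  (hH.ae_mem_frontier hV hx).mono fun _ hy => frontier_subset_closure hy

lemma integral_integral (hH : IsNormalHarmonicFamily 𝒱 H) (hU : U ∈ 𝒱) (hV : V ∈ 𝒱)
    (hUV : U ⊆ V) (hf : IsBoundedBorel f) (x : X) :
    ∫ y, (∫ z, f z ∂(H V y)) ∂(H U x) = ∫ z, f z ∂(H V x) := by
  have := hH.isMarkovKernel hU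
  have := hH.isMarkovKernel hV
  conv_rhs => rw [← hH.comp_eq V hV U hU hUV]
  exact (Kernel.integral_comp (hf.integrable _)).symm

lemma isHarmonic_integral (hH : IsNormalHarmonicFamily 𝒱 H) (hV : V ∈ 𝒱)
    (hf : IsBoundedBorel f) : IsHarmonic 𝒱 H V fun x => ∫ y, f y ∂(H V x) :=
  ⟨hH.continuousOn_apply V hV f hf, fun _ hU x _ =>
    hH.integral_integral hU.1 hV (subset_closure.trans hU.2) hf x⟩

lemma integral_of_notMem [BorelSpace X] [T2Space X] (hH : IsNormalHarmonicFamily 𝒱 H)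
    (hV : V ∈ 𝒱) (hx : x ∉ V) (f : X → ℝ) : ∫ y, f y ∂(H V x) = f x := by
  rw [(hH.isBoundaryKernel V hV).2 x hx, integral_dirac]

lemma continuousOn_closure_integral [BorelSpace X] [T4Space X]
    (hH : IsNormalHarmonicFamily 𝒱 H) (hV : V ∈ 𝒱) (hf : ContinuousOn f (frontier V)) :
    ContinuousOn (fun x => ∫ y, f y ∂(H V x)) (closure V) := by
  obtain ⟨F, hF⟩ := ContinuousMap.exists_restrict_eq (isClosed_frontier (s := V))
    ⟨(frontier V).domRestrict f, hf.domRestrict⟩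
  have hFf : ∀ y ∈ frontier V, F y = f y := fun y hy => congrArg (fun g => g ⟨y, hy⟩) hF
  refine (hH.continuous_apply V hV F F.continuous).continuousOn.congr fun x hx => ?_
  by_cases hxV : x ∈ V
  · exact integral_congr_ae ((hH.ae_mem_frontier hV hxV).mono fun y hy => (hFf y hy).symm)
  · change _ = ∫ y, F y ∂(H V x)
    rw [hH.integral_of_notMem hV hxV, hH.integral_of_notMem hV hxV,
      hFf x ((hH.isOpen hV).frontier_eq ▸ ⟨hx, hxV⟩)]

lemma not_ae_eq_self (hH : IsNormalHarmonicFamily 𝒱 H) (hV : V ∈ 𝒱) (hx : x ∈ V) :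
    ¬ ∀ᵐ y ∂(H V x), y = x := by
  intro h
  have := hH.isMarkovKernel hV
  obtain ⟨y, hy, rfl⟩ := ((hH.ae_mem_frontier hV hx).and h).exists
  exact ((hH.isOpen hV).frontier_eq ▸ hy).2 hx

lemma not_isOpen_singleton [RegularSpace X] (hH : IsNormalHarmonicFamily 𝒱 H) (x : X) :
    ¬ IsOpen {x} := by
  intro h
  obtain ⟨V, hV, hxV, hVx⟩ := hH.isBasis.exists_closure_subset (h.mem_nhds rfl)
  exact hH.not_ae_eq_self hV hxV ((hH.ae_mem_closure hV hxV).mono fun y hy => hVx hy)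

end IsNormalHarmonicFamily

lemma IsHarmonic.mono (hh : IsHarmonic 𝒱 H V h) (hUV : U ⊆ V) : IsHarmonic 𝒱 H U h :=
  ⟨hh.1.mono hUV, fun W hW => hh.2 W ⟨hW.1, hW.2.trans hUV⟩⟩

lemma IsHarmonic.congr (hH : IsNormalHarmonicFamily 𝒱 H) (hh : IsHarmonic 𝒱 H V h)
    (hfh : EqOn f h V) : IsHarmonic 𝒱 H V f := by
  refine ⟨hh.1.congr hfh, fun U hU x hx => ?_⟩
  rw [hfh (hU.2 (subset_closure hx)), ← hh.2 U hU x hx]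
  exact integral_congr_ae ((hH.ae_mem_closure hU.1 hx).mono fun z hz => hfh (hU.2 hz))

end Kernels

section Submean

variable {X : Type*} [TopologicalSpace X] [MeasurableSpace X] {𝒱 : Set (Set X)}
  {H : Set X → Kernel X X} {V : Set X} {g g' h : X → ℝ} {y : X}

/-- `g` is submean at `y`: `g(y) ≤ H_U g(y)` for arbitrarily small `U ∈ 𝒱` containing `y`. -/
def IsSubmeanAt (𝒱 : Set (Set X)) (H : Set X → Kernel X X) (g : X → ℝ) (y : X) : Prop :=
  ∀ O ∈ 𝓝 y, ∃ U ∈ 𝒱, y ∈ U ∧ closure U ⊆ O ∧ g y ≤ ∫ z, g z ∂(H U y)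

/-- `A` is absorbing: from every `y ∈ A`, arbitrarily small `U ∈ 𝒱` containing `y` are left
through `A`, that is, `H_U(y, ·)` is carried by `A`. -/
def IsAbsorbing (𝒱 : Set (Set X)) (H : Set X → Kernel X X) (A : Set X) : Prop :=
  ∀ y ∈ A, ∀ O ∈ 𝓝 y, ∃ U ∈ 𝒱, y ∈ U ∧ closure U ⊆ O ∧ ∀ᵐ z ∂(H U y), z ∈ A

lemma IsSubmeanAt.mono_of_eq (hH : IsNormalHarmonicFamily 𝒱 H) (hg : IsBoundedBorel g)
    (hg' : IsBoundedBorel g') (hle : g ≤ g') (heq : g y = g' y) (hsub : IsSubmeanAt 𝒱 H g y) :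
    IsSubmeanAt 𝒱 H g' y := by
  intro O hO
  obtain ⟨U, hU, hyU, hUO, hgU⟩ := hsub O hO
  have := hH.isMarkovKernel hU
  exact ⟨U, hU, hyU, hUO, heq ▸ hgU.trans (integral_mono (hg.integrable _) (hg'.integrable _) hle)⟩

lemma isSubmeanAt_of_eventually_le [RegularSpace X] (hH : IsNormalHarmonicFamily 𝒱 H)
    (hg : IsBoundedBorel g) (hmin : ∀ᶠ z in 𝓝 y, g y ≤ g z) : IsSubmeanAt 𝒱 H g y := by
  intro O hO
  obtain ⟨U, hU, hyU, hUO⟩ := hH.isBasis.exists_closure_subset (inter_mem hO hmin)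
  have := hH.isMarkovKernel hU
  have hle : ∫ _, g y ∂(H U y) ≤ ∫ z, g z ∂(H U y) :=
    integral_mono_ae (integrable_const _) (hg.integrable _)
      ((hH.ae_mem_closure hU hyU).mono fun z hz => (hUO hz).2)
  exact ⟨U, hU, hyU, fun z hz => (hUO hz).1, by simpa using hle⟩

lemma IsHarmonic.isSubmeanAt [RegularSpace X] (hH : IsNormalHarmonicFamily 𝒱 H)
    (hh : IsHarmonic 𝒱 H V h) (hV : V ∈ 𝓝 y) : IsSubmeanAt 𝒱 H h y := by
  intro O hO
  obtain ⟨U, hU, hyU, hUO⟩ := hH.isBasis.exists_closure_subset (inter_mem hO hV)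
  exact ⟨U, hU, hyU, hUO.trans inter_subset_left,
    (hh.2 U ⟨hU, hUO.trans inter_subset_right⟩ y hyU).ge⟩

lemma IsSubmeanAt.sub_of_isHarmonic (hH : IsNormalHarmonicFamily 𝒱 H) (hg : IsBoundedBorel g)
    (hsub : IsSubmeanAt 𝒱 H g y) (hhb : IsBoundedBorel h) (hh : IsHarmonic 𝒱 H V h)
    (hV : V ∈ 𝓝 y) : IsSubmeanAt 𝒱 H (g - h) y := by
  intro O hO
  obtain ⟨U, hU, hyU, hUO, hgU⟩ := hsub _ (inter_mem hO hV)
  have := hH.isMarkovKernel hU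
  refine ⟨U, hU, hyU, hUO.trans inter_subset_left, ?_⟩
  have hhU : ∫ z, h z ∂(H U y) = h y := hh.2 U ⟨hU, hUO.trans inter_subset_right⟩ y hyU
  simp only [Pi.sub_apply]
  rw [integral_sub (hg.integrable _) (hhb.integrable _), hhU]
  exact sub_le_sub_right hgU _

lemma isAbsorbing_setOf_eq (hH : IsNormalHarmonicFamily 𝒱 H) (hV : IsOpen V)
    (hg : IsBoundedBorel g) (hsub : ∀ y ∈ V, IsSubmeanAt 𝒱 H g y) {m : ℝ}
    (hm : ∀ y ∈ V, g y ≤ m) : IsAbsorbing 𝒱 H {y ∈ V | g y = m} := by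
  rintro y ⟨hy, hgy⟩ O hO
  obtain ⟨U, hU, hyU, hUO, hle⟩ := hsub y hy _ (inter_mem hO (hV.mem_nhds hy))
  have := hH.isMarkovKernel hU
  have hUV : ∀ᵐ z ∂(H U y), z ∈ V :=
    (hH.ae_mem_closure hU hyU).mono fun z hz => (hUO hz).2
  have heq : ∀ᵐ z ∂(H U y), g z = m :=
    ae_eq_const_of_le_integral (hg.integrable _) (hUV.mono hm) (hgy ▸ hle)
  exact ⟨U, hU, hyU, hUO.trans inter_subset_left, hUV.and heq⟩

end Submean

lemma lowerSemicontinuous_indicator {X : Type*} [TopologicalSpace X] {W : Set X}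
    {f : X → ENNReal} (hW : IsOpen W) (hf : LowerSemicontinuousOn f W) :
    LowerSemicontinuous (W.indicator f) := by
  intro x a ha
  by_cases hx : x ∈ W
  · rw [indicator_of_mem hx] at ha
    filter_upwards [hW.nhdsWithin_eq hx ▸ hf x hx a ha, hW.mem_nhds hx] with y hy hyW
    rwa [indicator_of_mem hyW]
  · exact absurd ha (by simp [hx])

section PSet

variable {X : Type*} [TopologicalSpace X] [MeasurableSpace X] {𝒱 : Set (Set X)}
  {H : Set X → Kernel X X} {U W : Set X} {x y : X}

/-- `f` is a bounded supermean function on `W`: the bounded nonnegative hyperharmonic functions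
on `W`, extended to Borel functions on `X`. -/
structure IsBoundedSupermean (𝒱 : Set (Set X)) (H : Set X → Kernel X X) (W : Set X) (f : X → ℝ) :
    Prop where
  lowerSemicontinuousOn : LowerSemicontinuousOn f W
  isBoundedBorel : IsBoundedBorel f
  nonneg : ∀ x, 0 ≤ f x
  integral_le : ∀ U ∈ inside 𝒱 W, ∀ x ∈ U, ∫ y, f y ∂(H U x) ≤ f x

lemma IsPSet.mono (hW : IsPSet 𝒱 H W) (hU : IsOpen U) (hUW : U ⊆ W) : IsPSet 𝒱 H U := by
  refine ⟨hU, fun x hx y hy hxy => ?_⟩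
  obtain ⟨u, ⟨hlsc, hbot, hle⟩, h0, hne⟩ := hW.2 x (hUW hx) y (hUW hy) hxy
  exact ⟨u, ⟨hlsc.mono hUW, fun z hz => hbot z (hUW hz),
    fun z hz V hV => hle z (hUW hz) V ⟨⟨hV.1.1, hV.1.2.trans hUW⟩, hV.2⟩⟩,
    fun z hz => h0 z (hUW hz), hne⟩

lemma IsHyperharmonic.lintegral_toENNReal_le {u : X → EReal} (hH : IsNormalHarmonicFamily 𝒱 H)
    (hu : IsHyperharmonic 𝒱 H W u) (hu0 : ∀ z ∈ W, 0 ≤ u z) (hU : U ∈ inside 𝒱 W) (hx : x ∈ U) :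
    ∫⁻ z, (u z).toENNReal ∂(H U x) ≤ (u x).toENNReal := by
  have hxW : x ∈ W := hU.2 (subset_closure hx)
  have hneg : ∫⁻ z, (-u z).toENNReal ∂(H U x) = 0 :=
    lintegral_eq_zero_of_ae_eq_zero ((hH.ae_mem_closure hU.1 hx).mono fun z hz =>
      EReal.toENNReal_of_nonpos (EReal.neg_le_zero.2 (hu0 z (hU.2 hz))))
  have hle := hu.2.2 x hxW U ⟨hU, hx⟩
  rw [eintegral, hneg, ← EReal.coe_toENNReal (hu0 x hxW)] at hle
  simpa using hle

lemma isBoundedSupermean_toReal_min [BorelSpace X] {v : X → ENNReal}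
    (hH : IsNormalHarmonicFamily 𝒱 H) (hv : LowerSemicontinuous v)
    (hle : ∀ U ∈ inside 𝒱 W, ∀ x ∈ U, ∫⁻ z, v z ∂(H U x) ≤ v x) (n : NNReal) :
    IsBoundedSupermean 𝒱 H W fun z => (min (v z) n).toReal := by
  have hfin : ∀ a : ENNReal, min a n ≠ ⊤ := fun a =>
    ((min_le_right a n).trans_lt ENNReal.coe_lt_top).ne
  have hcont : Continuous fun a : ENNReal => (min a n).toReal :=
    ENNReal.continuousOn_toReal.comp_continuous (continuous_id.min continuous_const) hfin
  have hmono : Monotone fun a : ENNReal => (min a n).toReal := fun a b hab =>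
    ENNReal.toReal_mono (hfin b) (min_le_min_right _ hab)
  have hmeas : Measurable fun z => min (v z) n := hv.measurable.min measurable_const
  refine ⟨(hcont.comp_lowerSemicontinuous hv hmono).lowerSemicontinuousOn _,
    isBoundedBorel_of_mem_Icc (a := 0) (b := n) hmeas.ennreal_toReal fun z =>
      ⟨ENNReal.toReal_nonneg, ENNReal.toReal_mono ENNReal.coe_ne_top (min_le_right (v z) n)⟩,
    fun z => ENNReal.toReal_nonneg, fun U hU x hx => ?_⟩
  have := hH.isMarkovKernel hU.1
  rw [integral_toReal hmeas.aemeasurable (.of_forall fun z => (hfin (v z)).lt_top)]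
  refine ENNReal.toReal_mono (hfin _) (le_min ?_ ?_)
  · exact (lintegral_mono fun z => min_le_left _ _).trans (hle U hU x hx)
  · exact (lintegral_mono fun z => min_le_right _ _).trans (by simp)

lemma exists_min_coe_ne {a b : ENNReal} (hab : a ≠ b) : ∃ n : NNReal, min a n ≠ min b n := by
  wlog hlt : a < b generalizing a b
  · obtain ⟨n, hn⟩ := this hab.symm (hab.lt_or_gt.resolve_left hlt)
    exact ⟨n, hn.symm⟩
  obtain ⟨n, han, hnb⟩ := ENNReal.lt_iff_exists_nnreal_btwn.1 hlt
  exact ⟨n, by rw [min_eq_left han.le, min_eq_right hnb.le]; exact han.ne⟩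

lemma IsPSet.exists_isBoundedSupermean [BorelSpace X] (hH : IsNormalHarmonicFamily 𝒱 H)
    (hW : IsPSet 𝒱 H W) (hx : x ∈ W) (hy : y ∈ W) (hxy : x ≠ y) :
    ∃ f : X → ℝ, IsBoundedSupermean 𝒱 H W f ∧ f x ≠ f y := by
  obtain ⟨u, hu, hu0, hne⟩ := hW.2 x hx y hy hxy
  set v : X → ENNReal := W.indicator fun z => (u z).toENNReal with hv
  have hvlsc : LowerSemicontinuous v := lowerSemicontinuous_indicator hW.1
    (EReal.continuous_toENNReal.comp_lowerSemicontinuousOn hu.1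
      fun _ _ => EReal.toENNReal_le_toENNReal)
  have hvle : ∀ U ∈ inside 𝒱 W, ∀ z ∈ U, ∫⁻ z', v z' ∂(H U z) ≤ v z := fun U hU z hz => by
    rw [hv, indicator_of_mem (hU.2 (subset_closure hz))]
    exact (lintegral_mono (indicator_le_self _ _)).trans
      (hu.lintegral_toENNReal_le hH hu0 hU hz)
  have hvne : v x ≠ v y := by
    rw [hv, indicator_of_mem hx, indicator_of_mem hy]
    exact fun h => hne ((EReal.toENNReal_eq_toENNReal (hu0 x hx) (hu0 y hy)).1 h)
  obtain ⟨n, hn⟩ := exists_min_coe_ne hvne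
  refine ⟨_, isBoundedSupermean_toReal_min hH hvlsc hvle n, fun h => hn ?_⟩
  exact (ENNReal.toReal_eq_toReal_iff' (by simp) (by simp)).1 h

end PSet

section Absorbing

lemma ae_mem_sInter_of_isClosed {X : Type*} [TopologicalSpace X] [SecondCountableTopology X]
    [MeasurableSpace X] {μ : Measure X} {c : Set (Set X)} (hc : ∀ A ∈ c, IsClosed A)
    (hμ : ∀ A ∈ c, ∀ᵐ x ∂μ, x ∈ A) : ∀ᵐ x ∂μ, x ∈ ⋂₀ c := by
  obtain ⟨T, hT, hTc, hTe⟩ := TopologicalSpace.isOpen_sUnion_countable (compl '' c)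
    (forall_mem_image.2 fun A hA => (hc A hA).isOpen_compl)
  rw [ae_iff]
  change μ (⋂₀ c)ᶜ = 0
  rw [compl_sInter, ← hTe, measure_sUnion_null_iff hT]
  exact fun B hB => (forall_mem_image (p := fun B => μ B = 0)).2 (fun A hA => hμ A hA) B (hTc hB)

/-- `A` is a nonempty closed subset of `M` that is invariant under the transition measures `μ`. -/
structure IsClosedInvariant {X : Type*} [TopologicalSpace X] [MeasurableSpace X]
    (μ : X → Measure X) (M A : Set X) : Prop where
  isClosed : IsClosed A
  nonempty : A.Nonempty
  subset : A ⊆ M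
  ae_mem : ∀ y ∈ A, ∀ᵐ z ∂(μ y), z ∈ A

section Invariant

variable {X : Type*} [TopologicalSpace X] [T2Space X] [MeasurableSpace X] {μ : X → Measure X}
  {M A : Set X}

lemma exists_minimal_isClosedInvariant [SecondCountableTopology X] (hM : IsCompact M)
    (hne : M.Nonempty) (hμ : ∀ y ∈ M, ∀ᵐ z ∂(μ y), z ∈ M) :
    ∃ A, Minimal (IsClosedInvariant μ M) A := by
  have hchains : ∀ c ⊆ {A | IsClosedInvariant μ M A}, IsChain (· ⊆ ·) c → c.Nonempty →
      ∃ B ∈ {A | IsClosedInvariant μ M A}, ∀ A ∈ c, B ⊆ A := by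
    intro c hc hchain hcne
    have hclosed : ∀ A ∈ c, IsClosed A := fun A hA => (hc hA).isClosed
    have : Nonempty c := hcne.to_subtype
    have hdir : DirectedOn (· ⊇ ·) c := fun A hA B hB =>
      (hchain.total hA hB).elim (fun h => ⟨A, hA, Subset.rfl, h⟩) fun h => ⟨B, hB, h, Subset.rfl⟩
    have hinter : (⋂₀ c).Nonempty :=
      IsCompact.nonempty_sInter_of_directed_nonempty_isCompact_isClosed hdir
        (fun A hA => (hc hA).nonempty)
        (fun A hA => hM.of_isClosed_subset (hclosed A hA) (hc hA).subset) hclosed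
    refine ⟨⋂₀ c, ⟨isClosed_sInter hclosed, hinter, ?_, fun y hy => ?_⟩,
      fun A hA => sInter_subset_of_mem hA⟩
    · exact hcne.elim fun A hA => (sInter_subset_of_mem hA).trans (hc hA).subset
    · exact ae_mem_sInter_of_isClosed hclosed fun A hA => (hc hA).ae_mem y (hy A hA)
  obtain ⟨A, -, hA⟩ := zorn_superset_nonempty _ hchains M ⟨hM.isClosed, hne, Subset.rfl, hμ⟩
  exact ⟨A, hA⟩

lemma IsClosedInvariant.exists_forall_eq_of_minimal (hM : IsCompact M)
    (hA : Minimal (IsClosedInvariant μ M) A) (hμ : ∀ y ∈ A, IsProbabilityMeasure (μ y))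
    {f : X → ℝ} (hf : LowerSemicontinuousOn f A) (hint : ∀ y ∈ A, Integrable f (μ y))
    (hle : ∀ y ∈ A, ∫ z, f z ∂(μ y) ≤ f y) : ∃ m, ∀ x ∈ A, f x = m := by
  have hAcomp : IsCompact A := hM.of_isClosed_subset hA.prop.isClosed hA.prop.subset
  obtain ⟨a, ha, hmin⟩ := hf.exists_isMinOn hA.prop.nonempty hAcomp
  have hlevel : ∀ y ∈ A ∩ f ⁻¹' Iic (f a), ∀ᵐ z ∂(μ y), z ∈ A ∩ f ⁻¹' Iic (f a) := by
    rintro y ⟨hyA, hya⟩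
    have := hμ y hyA
    have heq : ∀ᵐ z ∂(μ y), -f z = -f a :=
      ae_eq_const_of_le_integral (hint y hyA).neg
        ((hA.prop.ae_mem y hyA).mono fun z hz => neg_le_neg (hmin hz))
        (by simpa only [Pi.neg_apply, integral_neg, neg_le_neg_iff] using (hle y hyA).trans hya)
    exact (hA.prop.ae_mem y hyA).and (heq.mono fun z hz => (neg_injective hz).le)
  have hsub : A ⊆ A ∩ f ⁻¹' Iic (f a) := hA.le_of_le
    ⟨(hf.isCompact_inter_preimage_Iic hAcomp _).isClosed, ⟨a, ha, le_refl (f a)⟩,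
      inter_subset_left.trans hA.prop.subset, hlevel⟩ inter_subset_left
  exact ⟨f a, fun x hx => le_antisymm (hsub hx).2 (hmin hx)⟩

end Invariant

variable {X : Type*} [TopologicalSpace X] [MeasurableSpace X] [BorelSpace X] [T2Space X]
  [SecondCountableTopology X] {𝒱 : Set (Set X)} {H : Set X → Kernel X X} {W : Set X}

lemma IsPSet.eq_empty_of_isAbsorbing (hH : IsNormalHarmonicFamily 𝒱 H) (hW : IsPSet 𝒱 H W)
    {M : Set X} (hM : IsCompact M) (hMW : M ⊆ W) (habs : IsAbsorbing 𝒱 H M) : M = ∅ := by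
  by_contra hne
  have hchoice : ∀ y, ∃ U, y ∈ M → U ∈ inside 𝒱 W ∧ y ∈ U ∧ ∀ᵐ z ∂(H U y), z ∈ M := fun y => by
    by_cases hy : y ∈ M
    · obtain ⟨U, hU, hyU, hUW, hUM⟩ := habs y hy W (hW.1.mem_nhds (hMW hy))
      exact ⟨U, fun _ => ⟨⟨hU, hUW⟩, hyU, hUM⟩⟩
    · exact ⟨∅, fun h => absurd h hy⟩
  choose U hU using hchoice
  obtain ⟨A, hA⟩ := exists_minimal_isClosedInvariant (μ := fun y => H (U y) y) hM
    (nonempty_iff_ne_empty.2 hne) fun y hy => (hU y hy).2.2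
  have hAM : A ⊆ M := hA.prop.subset
  have hμ : ∀ y ∈ A, IsProbabilityMeasure (H (U y) y) := fun y hy =>
    (hH.isMarkovKernel (hU y (hAM hy)).1.1).isProbabilityMeasure y
  -- Bounded supermean functions are constant on `A`, but they separate its points.
  have hsing : ∀ x ∈ A, ∀ y ∈ A, y = x := fun x hx y hy => by
    by_contra hyx
    obtain ⟨f, hf, hne⟩ := hW.exists_isBoundedSupermean hH (hMW (hAM hy)) (hMW (hAM hx)) hyx
    obtain ⟨m, hm⟩ := IsClosedInvariant.exists_forall_eq_of_minimal hM hA hμ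
      (hf.lowerSemicontinuousOn.mono (hAM.trans hMW))
      (fun z hz => have := hμ z hz; hf.isBoundedBorel.integrable _)
      fun z hz => hf.integral_le _ (hU z (hAM hz)).1 z (hU z (hAM hz)).2.1
    exact hne ((hm y hy).trans (hm x hx).symm)
  obtain ⟨x, hx⟩ := hA.prop.nonempty
  obtain ⟨hUx, hxU, -⟩ := hU x (hAM hx)
  exact hH.not_ae_eq_self hUx.1 hxU ((hA.prop.ae_mem x hx).mono (hsing x hx))

/-- The maximum principle for the submean function `f - H_U h`, which is `≤ 0` on `∂U`. -/
lemma IsPSet.le_integral_of_isSubmeanAt [LocallyCompactSpace X] (hH : IsNormalHarmonicFamily 𝒱 H)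
    (hW : IsPSet 𝒱 H W) {U : Set X} (hU : U ∈ inside 𝒱 W) {f h : X → ℝ} (hf : IsBoundedBorel f)
    (hfu : UpperSemicontinuousOn f (closure U)) (hsub : ∀ y ∈ U, IsSubmeanAt 𝒱 H f y)
    (hh : IsBoundedBorel h) (hhc : ContinuousOn h (frontier U))
    (hfh : ∀ y ∈ frontier U, f y ≤ h y) : ∀ y ∈ U, f y ≤ ∫ z, h z ∂(H U y) := by
  have hUo := hH.isOpen hU.1
  have := hH.isMarkovKernel hU.1
  set k : X → ℝ := fun y => ∫ z, h z ∂(H U y)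
  have hkb : IsBoundedBorel k := hh.integral_kernel (H U)
  have hfr : ∀ y ∈ closure U, y ∉ U → (f - k) y ≤ 0 := fun y hy hyU => by
    simpa only [k, Pi.sub_apply, hH.integral_of_notMem hU.1 hyU, sub_nonpos] using
      hfh y (hUo.frontier_eq ▸ ⟨hy, hyU⟩)
  have husc : UpperSemicontinuousOn (f - k) (closure U) := by
    have hk := (hH.continuousOn_closure_integral hU.1 hhc).neg.upperSemicontinuousOn
    rw [sub_eq_add_neg]
    exact hfu.add hk
  by_contra! hlt
  obtain ⟨y₀, hy₀, hky₀⟩ := hlt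
  obtain ⟨a, ha, hmax⟩ := husc.exists_isMaxOn ⟨y₀, subset_closure hy₀⟩
    (hH.isCompact_closure U hU.1)
  have hpos : 0 < (f - k) a := (sub_pos.2 hky₀).trans_le (hmax (subset_closure hy₀))
  have hmem : ∀ y ∈ closure U, (f - k) y = (f - k) a → y ∈ U := fun y hy hya =>
    by_contra fun hyU => (hfr y hy hyU).not_gt (hya ▸ hpos)
  have hset : closure U ∩ (f - k) ⁻¹' Ici ((f - k) a) = {y ∈ U | (f - k) y = (f - k) a} := by
    refine Subset.antisymm (fun y hy => ?_) fun y hy => ⟨subset_closure hy.1, hy.2.ge⟩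
    have hya : (f - k) y = (f - k) a := le_antisymm (hmax hy.1) hy.2
    exact ⟨hmem y hy.1 hya, hya⟩
  have habs : IsAbsorbing 𝒱 H {y ∈ U | (f - k) y = (f - k) a} :=
    isAbsorbing_setOf_eq hH hUo (hf.sub hkb)
      (fun y hy => (hsub y hy).sub_of_isHarmonic hH hf hkb (hH.isHarmonic_integral hU.1 hh)
        (hUo.mem_nhds hy)) fun y hy => hmax (subset_closure hy)
  have hempty := hW.eq_empty_of_isAbsorbing hH
    (hset ▸ husc.isCompact_inter_preimage_Ici (hH.isCompact_closure U hU.1) _)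
    ((sep_subset _ _).trans (subset_closure.trans hU.2)) habs
  exact hempty.subset ⟨hmem a ha rfl, rfl⟩

end Absorbing

section Components

lemma isPreconnected_iInter_isClopen {Y : Type*} [TopologicalSpace Y] {y : Y}
    (hQ : IsOpen (⋂ s : {s : Set Y // IsClopen s ∧ y ∈ s}, s.1)) :
    IsPreconnected (⋂ s : {s : Set Y // IsClopen s ∧ y ∈ s}, s.1) := by
  set Q := ⋂ s : {s : Set Y // IsClopen s ∧ y ∈ s}, s.1
  have hQclopen : IsClopen Q := ⟨isClosed_iInter fun s => s.2.1.isClosed, hQ⟩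
  have hyQ : y ∈ Q := mem_iInter.2 fun s => s.2.2
  have huniv : ∀ s : Set Q, IsClopen s → ⟨y, hyQ⟩ ∈ s → s = univ := fun s hs hys => by
    have hclopen : IsClopen (Subtype.val '' s) :=
      ⟨hQclopen.isClosed.isClosedMap_subtype_val s hs.isClosed,
        hQclopen.isOpen.isOpenMap_subtype_val s hs.isOpen⟩
    refine eq_univ_of_forall fun z => ?_
    obtain ⟨w, hw, hwz⟩ := mem_iInter.1 z.2 ⟨_, hclopen, _, hys, rfl⟩
    exact Subtype.ext hwz ▸ hw
  rw [isPreconnected_iff_preconnectedSpace, preconnectedSpace_iff_clopen]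
  intro s hs
  by_cases hys : ⟨y, hyQ⟩ ∈ s
  · exact Or.inr (huniv s hs hys)
  · exact Or.inl (compl_univ_iff.1 (huniv sᶜ hs.compl hys))

lemma isOpen_connectedComponent_of_isOpen_iInter_isClopen {Y : Type*} [TopologicalSpace Y] {y : Y}
    (hQ : IsOpen (⋂ s : {s : Set Y // IsClopen s ∧ y ∈ s}, s.1)) :
    IsOpen (connectedComponent y) := by
  have heq : connectedComponent y = ⋂ s : {s : Set Y // IsClopen s ∧ y ∈ s}, s.1 :=
    connectedComponent_subset_iInter_isClopen.antisymm
      ((isPreconnected_iInter_isClopen hQ).subset_connectedComponent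
        (mem_iInter.2 fun s => s.2.2))
  rwa [heq]

lemma eventually_indicator_one_eq {Y : Type*} [TopologicalSpace Y] {U A : Set Y} (hA : IsOpen A)
    (hUA : IsOpen (U \ A)) {y : Y} (hy : y ∈ U) :
    ∀ᶠ z in 𝓝 y, A.indicator (1 : Y → ℝ) z = A.indicator (1 : Y → ℝ) y := by
  by_cases hyA : y ∈ A
  · filter_upwards [hA.mem_nhds hyA] with z hz
    rw [indicator_of_mem hz, indicator_of_mem hyA, Pi.one_apply, Pi.one_apply]
  · filter_upwards [hUA.mem_nhds ⟨hy, hyA⟩] with z hz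
    rw [indicator_of_notMem hz.2, indicator_of_notMem hyA]

lemma isOpen_of_ae_mem {X : Type*} [TopologicalSpace X] [RegularSpace X] [MeasurableSpace X]
    {𝒱 : Set (Set X)} {H : Set X → Kernel X X} {U Q : Set X} (hH : IsNormalHarmonicFamily 𝒱 H)
    (hU : IsOpen U) (hQU : Q ⊆ U) (hQ : MeasurableSet Q)
    (hin : ∀ V ∈ inside 𝒱 U, ∀ y ∈ V, y ∈ Q → ∀ᵐ z ∂(H V y), z ∈ Q)
    (hout : ∀ V ∈ inside 𝒱 U, ∀ y ∈ V, y ∉ Q → ∀ᵐ z ∂(H V y), z ∉ Q) : IsOpen Q := by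
  refine isOpen_iff_mem_nhds.2 fun y hy => ?_
  obtain ⟨V, hV, hyV, hVU⟩ := hH.isBasis.exists_closure_subset (hU.mem_nhds (hQU hy))
  have := hH.isMarkovKernel hV
  set p : X → ℝ := fun z => ∫ w, Q.indicator 1 w ∂(H V z)
  have hpy : p y = 1 := by
    have h1 : ∀ᵐ w ∂(H V y), Q.indicator (1 : X → ℝ) w = 1 :=
      (hin V ⟨hV, hVU⟩ y hyV hy).mono fun w hw => indicator_of_mem hw _
    simp only [p, integral_congr_ae h1, integral_const, probReal_univ, smul_eq_mul, mul_one]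
  have hp : ContinuousAt p y :=
    (hH.continuousOn_apply V hV _ (isBoundedBorel_indicator_one hQ)).continuousAt
      ((hH.isOpen hV).mem_nhds hyV)
  filter_upwards [hp.eventually_ne (hpy ▸ one_ne_zero), (hH.isOpen hV).mem_nhds hyV] with z hz hzV
  by_contra hzQ
  exact hz (integral_eq_zero_of_ae ((hout V ⟨hV, hVU⟩ z hzV hzQ).mono fun w hw =>
    indicator_of_notMem hw _))

variable {X : Type*} [TopologicalSpace X] [MeasurableSpace X] [BorelSpace X] [T2Space X]
  [LocallyCompactSpace X] [SecondCountableTopology X] {𝒱 : Set (Set X)} {H : Set X → Kernel X X}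
  {U V W : Set X} {y : X}

lemma IsPSet.ae_mem_of_isOpen_sdiff (hH : IsNormalHarmonicFamily 𝒱 H) (hW : IsPSet 𝒱 H W)
    (hUW : U ⊆ W) {A : Set X} (hA : IsOpen A) (hUA : IsOpen (U \ A)) (hV : V ∈ inside 𝒱 U)
    (hyV : y ∈ V) (hyA : y ∈ A) : ∀ᵐ z ∂(H V y), z ∈ A := by
  have := hH.isMarkovKernel hV.1
  set f : X → ℝ := A.indicator 1
  have hfb : IsBoundedBorel f := isBoundedBorel_indicator_one hA.measurableSet
  have hloc : ∀ z ∈ U, ∀ᶠ w in 𝓝 z, f w = f z := fun z hz => eventually_indicator_one_eq hA hUA hz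
  have hcont : ContinuousOn f U := fun z hz =>
    (continuousAt_const.congr ((hloc z hz).mono fun w hw => hw.symm)).continuousWithinAt
  have hle : f y ≤ ∫ z, f z ∂(H V y) :=
    hW.le_integral_of_isSubmeanAt hH ⟨hV.1, hV.2.trans hUW⟩ hfb
      (hcont.mono hV.2).upperSemicontinuousOn
      (fun z hz => isSubmeanAt_of_eventually_le hH hfb
        ((hloc z (hV.2 (subset_closure hz))).mono fun w hw => hw.ge))
      hfb (hcont.mono (frontier_subset_closure.trans hV.2)) (fun z _ => le_rfl) y hyV
  have hf1 : ∀ᵐ z ∂(H V y), f z = 1 :=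
    ae_eq_const_of_le_integral (hfb.integrable _)
      (.of_forall fun z => indicator_le_self' (fun _ _ => zero_le_one) z)
      (by simpa only [f, indicator_of_mem hyA, Pi.one_apply] using hle)
  exact hf1.mono fun z hz => mem_of_indicator_ne_zero (hz ▸ one_ne_zero)

lemma IsPSet.ae_mem_image_of_isClopen (hH : IsNormalHarmonicFamily 𝒱 H) (hW : IsPSet 𝒱 H W)
    (hU : IsOpen U) (hUW : U ⊆ W) {s : Set U} (hs : IsClopen s) (hV : V ∈ inside 𝒱 U)
    (hyV : y ∈ V) (hys : y ∈ Subtype.val '' s) : ∀ᵐ z ∂(H V y), z ∈ Subtype.val '' s := by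
  have hdiff : U \ Subtype.val '' s = Subtype.val '' sᶜ := by
    rw [image_compl_eq_range_sdiff_image Subtype.val_injective, Subtype.range_val]
  exact hW.ae_mem_of_isOpen_sdiff hH hUW (hU.isOpenMap_subtype_val s hs.isOpen)
    (hdiff ▸ hU.isOpenMap_subtype_val sᶜ hs.compl.isOpen) hV hyV hys

lemma IsPSet.ae_mem_image_iInter_of_isClopen (hH : IsNormalHarmonicFamily 𝒱 H)
    (hW : IsPSet 𝒱 H W) (hU : IsOpen U) (hUW : U ⊆ W) {ι : Type*} {s : ι → Set U}
    (hs : ∀ i, IsClopen (s i)) (hV : V ∈ inside 𝒱 U) (hyV : y ∈ V)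
    (hys : y ∈ Subtype.val '' ⋂ i, s i) : ∀ᵐ z ∂(H V y), z ∈ Subtype.val '' ⋂ i, s i := by
  have hclosed : ∀ᵐ z ∂(H V y), z ∈ ⋂₀ range fun i => (Subtype.val '' (s i)ᶜ)ᶜ := by
    refine ae_mem_sInter_of_isClosed (forall_mem_range.2 fun i => ?_)
      (forall_mem_range.2 fun i => ?_)
    · exact (hU.isOpenMap_subtype_val _ (hs i).compl.isOpen).isClosed_compl
    · exact (hW.ae_mem_image_of_isClopen hH hU hUW (hs i) hV hyV
        (image_mono (iInter_subset s i) hys)).mono fun z hz =>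
          ((disjoint_image_iff Subtype.val_injective).2 disjoint_compl_right).notMem_of_mem_left hz
  filter_upwards [hclosed, hH.ae_mem_closure hV.1 hyV] with z hz hzV
  refine ⟨⟨z, hV.2 hzV⟩, mem_iInter.2 fun i => ?_, rfl⟩
  by_contra hzi
  exact hz _ (mem_range_self i) ⟨_, hzi, rfl⟩

/-- A quasicomponent of `U` and its complement in `U` are invariant under the kernels `H_V`; hence
it is open and therefore a component. -/
lemma IsPSet.isOpen_connectedComponentIn (hH : IsNormalHarmonicFamily 𝒱 H) (hW : IsPSet 𝒱 H W)
    (hU : IsOpen U) (hUW : U ⊆ W) (x : X) : IsOpen (connectedComponentIn U x) := by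
  by_cases hx : x ∈ U
  swap
  · rw [connectedComponentIn_eq_empty hx]
    exact isOpen_empty
  rw [connectedComponentIn_eq_image hx]
  refine hU.isOpenMap_subtype_val _ (isOpen_connectedComponent_of_isOpen_iInter_isClopen ?_)
  set Q := ⋂ s : {s : Set U // IsClopen s ∧ ⟨x, hx⟩ ∈ s}, s.1
  have hQ : MeasurableSet Q := (isClosed_iInter fun s => s.2.1.isClosed).measurableSet
  have hQo : IsOpen (Subtype.val '' Q) := by
    refine isOpen_of_ae_mem hH hU (Subtype.coe_image_subset U Q)
      (.subtype_image hU.measurableSet hQ) (fun V hV y hyV hyQ => ?_) fun V hV y hyV hyQ => ?_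
    · exact hW.ae_mem_image_iInter_of_isClopen hH hU hUW (fun s => s.2.1) hV hyV hyQ
    · obtain ⟨s, hs⟩ : ∃ s : {s : Set U // IsClopen s ∧ ⟨x, hx⟩ ∈ s},
          ⟨y, hV.2 (subset_closure hyV)⟩ ∉ s.1 := by
        by_contra! h
        exact hyQ ⟨_, mem_iInter.2 h, rfl⟩
      filter_upwards [hW.ae_mem_image_of_isClopen hH hU hUW s.2.1.compl hV hyV ⟨_, hs, rfl⟩]
        with z hz hzQ
      exact ((disjoint_image_iff Subtype.val_injective).2 disjoint_compl_left).notMem_of_mem_left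
        hz (image_mono (iInter_subset _ s) hzQ)
  rw [← preimage_image_eq Q Subtype.val_injective]
  exact hQo.preimage continuous_subtype_val

end Components

section Elliptic

lemma exists_mem_closure_connectedComponentIn {X : Type*} [TopologicalSpace X] {F S : Set X}
    {x : X} (hS : IsPreconnected S) (hopen : IsOpen (connectedComponentIn F x))
    (hne : (S ∩ connectedComponentIn F x).Nonempty) (hSF : ¬ S ⊆ connectedComponentIn F x) :
    ∃ y ∈ S, y ∈ closure (connectedComponentIn F x) ∧ y ∉ F := by
  by_contra! h
  have hx : x ∈ F := connectedComponentIn_nonempty_iff.1 (hne.mono inter_subset_right)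
  have hclosure : closure (connectedComponentIn F x) ∩ F ⊆ connectedComponentIn F x :=
    (isPreconnected_connectedComponentIn.subset_closure
      (subset_inter subset_closure (connectedComponentIn_subset F x))
      inter_subset_left).subset_connectedComponentIn
      ⟨subset_closure (mem_connectedComponentIn hx), hx⟩ inter_subset_right
  exact hSF (hS.subset_of_closure_inter_subset hopen hne
    fun y hy => hclosure ⟨hy.1, h y hy.2 hy.1⟩)

variable {X : Type*} [TopologicalSpace X] [MeasurableSpace X] [BorelSpace X] [T2Space X]
  [LocallyCompactSpace X] [SecondCountableTopology X] {𝒱 : Set (Set X)} {H : Set X → Kernel X X}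
  {G U W Z : Set X} {x y : X}

/-- Ellipticity makes the harmonic measure at `y` charge every neighborhood of every boundary point
of the component of `y`. -/
lemma IsElliptic.closure_connectedComponentIn_sdiff_subset (hH : IsNormalHarmonicFamily 𝒱 H)
    (hell : IsElliptic 𝒱 H) (hU : U ∈ 𝒱) (hopen : IsOpen (connectedComponentIn U y)) (hy : y ∈ U)
    {F : Set X} (hF : IsClosed F) (hae : ∀ᵐ z ∂(H U y), z ∈ F) :
    closure (connectedComponentIn U y) \ U ⊆ F := by
  rintro b ⟨hb, hbU⟩
  by_contra hbF
  obtain ⟨f, hf0, hf1, hf⟩ := exists_continuous_zero_one_of_isClosed hF isClosed_singleton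
    (disjoint_singleton_right.2 hbF)
  have hfb : IsBoundedBorel f := isBoundedBorel_of_mem_Icc f.continuous.measurable hf
  have hcont := hH.continuous_apply U hU f f.continuous
  have hpos : 0 < ∫ z, f z ∂(H U b) := by
    rw [hH.integral_of_notMem hU hbU, hf1 rfl]
    exact zero_lt_one
  obtain ⟨q, hq, hqy⟩ := mem_closure_iff.1 hb {z | 0 < ∫ w, f w ∂(H U z)}
    (isOpen_lt continuous_const hcont) hpos
  have hzero : ∫ z, f z ∂(H U y) = 0 := integral_eq_zero_of_ae (hae.mono fun z hz => hf0 hz)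
  have hyy : y ∈ connectedComponentIn U y := mem_connectedComponentIn hy
  rcases hell _ hopen ⟨⟨y, hyy⟩, isPreconnected_connectedComponentIn⟩ _
    ((hH.isHarmonic_integral hU hfb).mono (connectedComponentIn_subset U y))
    (fun z _ => integral_nonneg fun w => (hf w).1) with h | h
  · exact (h q hqy).not_gt hq
  · exact (h y hyy).ne' hzero

lemma IsPSet.eq_of_isAbsorbing (hH : IsNormalHarmonicFamily 𝒱 H) (hell : IsElliptic 𝒱 H)
    (hW : IsPSet 𝒱 H W) (hG : IsPreconnected G) (hGo : IsOpen G) (hGW : G ⊆ W) (hZG : Z ⊆ G)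
    (hGZ : IsOpen (G \ Z)) (hZ : Z.Nonempty) (habs : IsAbsorbing 𝒱 H Z) : Z = G := by
  refine hZG.antisymm fun b₀ hb₀ => by_contra fun hb₀Z => ?_
  set B := connectedComponentIn (G \ Z) b₀
  have hBGZ : B ⊆ G \ Z := connectedComponentIn_subset _ _
  have hb₀B : b₀ ∈ B := mem_connectedComponentIn ⟨hb₀, hb₀Z⟩
  obtain ⟨y, hyG, hyB, hyGZ⟩ : ∃ y ∈ G, y ∈ closure B ∧ y ∉ G \ Z :=
    exists_mem_closure_connectedComponentIn hG
      (hW.isOpen_connectedComponentIn hH hGZ (sdiff_subset.trans hGW) b₀) ⟨b₀, hb₀, hb₀B⟩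
      fun h => hZ.elim fun z hz => (hBGZ (h (hZG hz))).2 hz
  have hyZ : y ∈ Z := by_contra fun h => hyGZ ⟨hyG, h⟩
  have hyb₀ : y ≠ b₀ := fun h => hb₀Z (h ▸ hyZ)
  obtain ⟨U, hU, hyU, hUG, hUZ⟩ := habs y hyZ _
    (inter_mem (hGo.mem_nhds hyG) (isOpen_ne.mem_nhds hyb₀))
  have hopen : IsOpen (connectedComponentIn U y) :=
    hW.isOpen_connectedComponentIn hH (hH.isOpen hU)
      (subset_closure.trans (hUG.trans (inter_subset_left.trans hGW))) y
  obtain ⟨b, hbB, hb, hbU⟩ : ∃ b ∈ B, b ∈ closure (connectedComponentIn U y) ∧ b ∉ U := by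
    refine exists_mem_closure_connectedComponentIn isPreconnected_connectedComponentIn hopen ?_ ?_
    · rw [inter_comm]
      exact mem_closure_iff.1 hyB _ hopen (mem_connectedComponentIn hyU)
    · exact fun h => (hUG (subset_closure (connectedComponentIn_subset U y (h hb₀B)))).2 rfl
  exact hell.closure_connectedComponentIn_sdiff_subset hH hU hopen hyU hGZ.isClosed_compl
    (hUZ.mono fun z hz h => h.2 hz) ⟨hb, hbU⟩ (hBGZ hbB)

lemma IsPSet.eq_of_isSubmeanAt_of_forall_le (hH : IsNormalHarmonicFamily 𝒱 H)
    (hell : IsElliptic 𝒱 H) (hW : IsPSet 𝒱 H W) (hG : IsPreconnected G) (hGo : IsOpen G)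
    (hGW : G ⊆ W) {g : X → ℝ} (hg : IsBoundedBorel g) (hgu : UpperSemicontinuousOn g G)
    (hsub : ∀ y ∈ G, IsSubmeanAt 𝒱 H g y) (hx : x ∈ G) (hmax : ∀ y ∈ G, g y ≤ g x) :
    ∀ y ∈ G, g y = g x := by
  have hdiff : G \ {y ∈ G | g y = g x} = G ∩ g ⁻¹' Iio (g x) := by
    ext y
    exact ⟨fun h => ⟨h.1, (hmax y h.1).lt_of_ne fun h' => h.2 ⟨h.1, h'⟩⟩,
      fun h => ⟨h.1, fun h' => h.2.ne h'.2⟩⟩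
  have hopen : IsOpen (G \ {y ∈ G | g y = g x}) := by
    obtain ⟨O, hO, hOG⟩ := upperSemicontinuousOn_iff_preimage_Iio.1 hgu (g x)
    rw [hdiff, hOG]
    exact hGo.inter hO
  have heq : {y ∈ G | g y = g x} = G :=
    hW.eq_of_isAbsorbing hH hell hG hGo hGW (sep_subset _ _) hopen ⟨x, hx, rfl⟩
      (isAbsorbing_setOf_eq hH hGo hg hsub hmax)
  exact fun y hy => (heq.ge hy).2

end Elliptic

section Reduced

variable {X : Type*} [TopologicalSpace X] [MeasurableSpace X] {𝒱 : Set (Set X)}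
  {H : Set X → Kernel X X} {U W C : Set X} {e : ℕ → Set X} {f φ : X → ℝ} {y : X}

/-- The sets `e 0, e 1, …` form a base of `W` in which every set used is listed infinitely often.
The reduced function of `φ` is obtained by balayage over these sets in turn, so that each of them
has to be visited again and again. -/
structure IsRecurrentBase (𝒱 : Set (Set X)) (W : Set X) (e : ℕ → Set X) : Prop where
  mem_inside : ∀ n, e n ∈ inside 𝒱 W
  exists_frequently_eq : ∀ y ∈ W, ∀ O ∈ 𝓝 y, ∃ U, y ∈ U ∧ closure U ⊆ O ∧ ∃ᶠ n in atTop, e n = U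

/-- The functions obtained from `φ` by balayage over `e 0, …, e (n - 1)` in turn, increasing to the
reduced function of `φ`. -/
noncomputable def reduceSeq (H : Set X → Kernel X X) (e : ℕ → Set X) (φ : X → ℝ) : ℕ → X → ℝ
  | 0 => φ
  | n + 1 => fun x => max (reduceSeq H e φ n x) (∫ y, reduceSeq H e φ n y ∂(H (e n) x))

/-- The reduced function of `φ`: the smallest supermean majorant of `φ` on `W` if `e` is a
recurrent base of `W`. -/
noncomputable def reduced (H : Set X → Kernel X X) (e : ℕ → Set X) (φ : X → ℝ) (x : X) : ℝ :=
  ⨆ n, reduceSeq H e φ n x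

lemma monotone_reduceSeq {X : Type*} [MeasurableSpace X] (H : Set X → Kernel X X)
    (e : ℕ → Set X) (φ : X → ℝ) : Monotone (reduceSeq H e φ) :=
  monotone_nat_of_le_succ fun _ _ => le_max_left _ _

lemma continuous_reduceSeq (hH : IsNormalHarmonicFamily 𝒱 H) (he : ∀ n, e n ∈ 𝒱)
    (hφ : Continuous φ) (n : ℕ) : Continuous (reduceSeq H e φ n) := by
  induction n with
  | zero => exact hφ
  | succ n ih => exact ih.max (hH.continuous_apply _ (he n) _ ih)

lemma IsNormalHarmonicFamily.exists_isRecurrentBase [RegularSpace X] [SecondCountableTopology X]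
    (hH : IsNormalHarmonicFamily 𝒱 H) (hWo : IsOpen W) (hWne : W.Nonempty) :
    ∃ e, IsRecurrentBase 𝒱 W e := by
  obtain ⟨B, hB𝒱, hBc, hB⟩ := hH.isBasis.exists_countable
  have hsmall : ∀ y ∈ W, ∀ O ∈ 𝓝 y, ∃ U ∈ {U ∈ B | closure U ⊆ W}, y ∈ U ∧ closure U ⊆ O := by
    intro y hy O hO
    obtain ⟨U, hU, hyU, hUO⟩ := hB.exists_closure_subset (inter_mem hO (hWo.mem_nhds hy))
    exact ⟨U, ⟨hU, hUO.trans inter_subset_right⟩, hyU, hUO.trans inter_subset_left⟩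
  obtain ⟨x, hx⟩ := hWne
  obtain ⟨U, hU, -⟩ := hsmall x hx univ univ_mem
  obtain ⟨a, ha⟩ := (hBc.mono (sep_subset B fun U => closure U ⊆ W)).exists_eq_range ⟨U, hU⟩
  refine ⟨fun n => a (Nat.unpair n).1, fun n => ?_, fun y hy O hO => ?_⟩
  · have hn : a (Nat.unpair n).1 ∈ {U ∈ B | closure U ⊆ W} := ha ▸ mem_range_self _
    exact ⟨hB𝒱 hn.1, hn.2⟩
  · obtain ⟨U, hU, hyU, hUO⟩ := hsmall y hy O hO
    obtain ⟨i, rfl⟩ := ha ▸ hU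
    exact ⟨a i, hyU, hUO, frequently_atTop.2 fun m =>
      ⟨Nat.pair i m, Nat.right_le_pair i m, by rw [Nat.unpair_pair]⟩⟩

variable [BorelSpace X]

lemma reduceSeq_mem_Icc (hH : IsNormalHarmonicFamily 𝒱 H) (he : ∀ n, e n ∈ 𝒱)
    (hφ : Continuous φ) (h01 : ∀ x, φ x ∈ Icc (0 : ℝ) 1) (n : ℕ) (x : X) :
    reduceSeq H e φ n x ∈ Icc (0 : ℝ) 1 := by
  induction n generalizing x with
  | zero => exact h01 x
  | succ n ih =>
    have := hH.isMarkovKernel (he n)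
    have hb : IsBoundedBorel (reduceSeq H e φ n) :=
      isBoundedBorel_of_mem_Icc (continuous_reduceSeq hH he hφ n).measurable ih
    have hle : ∫ y, reduceSeq H e φ n y ∂(H (e n) x) ≤ ∫ _, 1 ∂(H (e n) x) :=
      integral_mono (hb.integrable _) (integrable_const 1) fun y => (ih y).2
    exact ⟨(ih x).1.trans (le_max_left _ _), max_le (ih x).2 (by simpa using hle)⟩

lemma isBoundedBorel_reduceSeq (hH : IsNormalHarmonicFamily 𝒱 H) (he : ∀ n, e n ∈ 𝒱)
    (hφ : Continuous φ) (h01 : ∀ x, φ x ∈ Icc (0 : ℝ) 1) (n : ℕ) :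
    IsBoundedBorel (reduceSeq H e φ n) :=
  isBoundedBorel_of_mem_Icc (continuous_reduceSeq hH he hφ n).measurable
    (reduceSeq_mem_Icc hH he hφ h01 n)

lemma bddAbove_range_reduceSeq (hH : IsNormalHarmonicFamily 𝒱 H) (he : ∀ n, e n ∈ 𝒱)
    (hφ : Continuous φ) (h01 : ∀ x, φ x ∈ Icc (0 : ℝ) 1) (x : X) :
    BddAbove (range fun n => reduceSeq H e φ n x) :=
  ⟨1, forall_mem_range.2 fun n => (reduceSeq_mem_Icc hH he hφ h01 n x).2⟩

lemma reduceSeq_le_reduced (hH : IsNormalHarmonicFamily 𝒱 H) (he : ∀ n, e n ∈ 𝒱)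
    (hφ : Continuous φ) (h01 : ∀ x, φ x ∈ Icc (0 : ℝ) 1) (n : ℕ) :
    reduceSeq H e φ n ≤ reduced H e φ :=
  fun x => le_ciSup (bddAbove_range_reduceSeq hH he hφ h01 x) n

lemma reduced_mem_Icc (hH : IsNormalHarmonicFamily 𝒱 H) (he : ∀ n, e n ∈ 𝒱)
    (hφ : Continuous φ) (h01 : ∀ x, φ x ∈ Icc (0 : ℝ) 1) (x : X) :
    reduced H e φ x ∈ Icc (0 : ℝ) 1 :=
  ⟨(h01 x).1.trans (reduceSeq_le_reduced hH he hφ h01 0 x),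
    ciSup_le fun n => (reduceSeq_mem_Icc hH he hφ h01 n x).2⟩

lemma lowerSemicontinuous_reduced (hH : IsNormalHarmonicFamily 𝒱 H) (he : ∀ n, e n ∈ 𝒱)
    (hφ : Continuous φ) (h01 : ∀ x, φ x ∈ Icc (0 : ℝ) 1) :
    LowerSemicontinuous (reduced H e φ) :=
  lowerSemicontinuous_ciSup (bddAbove_range_reduceSeq hH he hφ h01) fun n =>
    (continuous_reduceSeq hH he hφ n).lowerSemicontinuous

lemma isBoundedBorel_reduced (hH : IsNormalHarmonicFamily 𝒱 H) (he : ∀ n, e n ∈ 𝒱)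
    (hφ : Continuous φ) (h01 : ∀ x, φ x ∈ Icc (0 : ℝ) 1) : IsBoundedBorel (reduced H e φ) :=
  isBoundedBorel_of_mem_Icc (lowerSemicontinuous_reduced hH he hφ h01).measurable
    (reduced_mem_Icc hH he hφ h01)

lemma tendsto_integral_reduceSeq (hH : IsNormalHarmonicFamily 𝒱 H) (he : ∀ n, e n ∈ 𝒱)
    (hφ : Continuous φ) (h01 : ∀ x, φ x ∈ Icc (0 : ℝ) 1) (μ : Measure X) [IsFiniteMeasure μ] :
    Tendsto (fun n => ∫ y, reduceSeq H e φ n y ∂μ) atTop (𝓝 (∫ y, reduced H e φ y ∂μ)) :=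
  integral_tendsto_of_tendsto_of_monotone
    (fun n => (isBoundedBorel_reduceSeq hH he hφ h01 n).integrable μ)
    ((isBoundedBorel_reduced hH he hφ h01).integrable μ)
    (.of_forall fun y _ _ hmn => monotone_reduceSeq H e φ hmn y)
    (.of_forall fun y => tendsto_atTop_ciSup (fun _ _ hmn => monotone_reduceSeq H e φ hmn y)
      (bddAbove_range_reduceSeq hH he hφ h01 y))

lemma integral_reduced_le_of_frequently_eq (hH : IsNormalHarmonicFamily 𝒱 H) (he : ∀ n, e n ∈ 𝒱)
    (hφ : Continuous φ) (h01 : ∀ x, φ x ∈ Icc (0 : ℝ) 1) (hU : ∃ᶠ n in atTop, e n = U) (x : X) :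
    ∫ y, reduced H e φ y ∂(H U x) ≤ reduced H e φ x := by
  obtain ⟨m, rfl⟩ := hU.exists
  have := hH.isMarkovKernel (he m)
  refine le_of_tendsto_of_frequently (tendsto_integral_reduceSeq hH he hφ h01 (H (e m) x)) ?_
  refine hU.mono fun n hn => ?_
  rw [← hn]
  exact (le_max_right _ _).trans (reduceSeq_le_reduced hH he hφ h01 (n + 1) x)

lemma IsRecurrentBase.isSubmeanAt_neg_reduced (he : IsRecurrentBase 𝒱 W e)
    (hH : IsNormalHarmonicFamily 𝒱 H) (hφ : Continuous φ) (h01 : ∀ x, φ x ∈ Icc (0 : ℝ) 1)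
    (hy : y ∈ W) : IsSubmeanAt 𝒱 H (-reduced H e φ) y := by
  intro O hO
  obtain ⟨U, hyU, hUO, hU⟩ := he.exists_frequently_eq y hy O hO
  obtain ⟨m, rfl⟩ := hU.exists
  refine ⟨e m, (he.mem_inside m).1, hyU, hUO, ?_⟩
  simp only [Pi.neg_apply]
  rw [integral_neg, neg_le_neg_iff]
  exact integral_reduced_le_of_frequently_eq hH (fun n => (he.mem_inside n).1) hφ h01 hU y

variable [T2Space X]

lemma isSubmeanAt_reduceSeq [RegularSpace X] (hH : IsNormalHarmonicFamily 𝒱 H)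
    (he : ∀ n, e n ∈ 𝒱) (hφ : Continuous φ) (h01 : ∀ x, φ x ∈ Icc (0 : ℝ) 1) (hy : φ y = 0)
    (n : ℕ) : IsSubmeanAt 𝒱 H (reduceSeq H e φ n) y := by
  have hb := isBoundedBorel_reduceSeq hH he hφ h01
  induction n with
  | zero => exact isSubmeanAt_of_eventually_le hH (hb 0) (.of_forall fun z => hy.trans_le (h01 z).1)
  | succ n ih =>
    have := hH.isMarkovKernel (he n)
    rcases le_or_gt (∫ z, reduceSeq H e φ n z ∂(H (e n) y)) (reduceSeq H e φ n y) with h | h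
    · exact ih.mono_of_eq hH (hb n) (hb (n + 1)) (fun z => le_max_left _ _) (max_eq_left h).symm
    · have hye : y ∈ e n := by
        by_contra hye
        exact h.ne' (hH.integral_of_notMem (he n) hye _)
      exact (IsHarmonic.isSubmeanAt hH (hH.isHarmonic_integral (he n) (hb n))
        ((hH.isOpen (he n)).mem_nhds hye)).mono_of_eq hH ((hb n).integral_kernel _) (hb (n + 1))
          (fun z => le_max_right _ _) (max_eq_right h.le).symm

lemma mul_reduced_le (hH : IsNormalHarmonicFamily 𝒱 H) (he : ∀ n, e n ∈ inside 𝒱 W)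
    (hφ : Continuous φ) (h01 : ∀ x, φ x ∈ Icc (0 : ℝ) 1) (hf : IsBoundedSupermean 𝒱 H W f) {t : ℝ}
    (ht : 0 ≤ t) (hle : ∀ x ∈ W, t * φ x ≤ f x) : ∀ x ∈ W, t * reduced H e φ x ≤ f x := by
  have hseq : ∀ n, ∀ x ∈ W, t * reduceSeq H e φ n x ≤ f x := by
    intro n
    induction n with
    | zero => exact hle
    | succ n ih =>
      intro x hx
      have := hH.isMarkovKernel (he n).1
      simp only [reduceSeq]
      rw [mul_max_of_nonneg _ _ ht, ← integral_const_mul]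
      refine max_le (ih x hx) ?_
      by_cases hxe : x ∈ e n
      · have hb := isBoundedBorel_reduceSeq hH (fun n => (he n).1) hφ h01 n
        exact (integral_mono_ae ((hb.integrable _).const_mul t) (hf.isBoundedBorel.integrable _)
          ((hH.ae_mem_closure (he n).1 hxe).mono fun y hy => ih y ((he n).2 hy))).trans
            (hf.integral_le _ (he n) x hxe)
      · rw [hH.integral_of_notMem (he n).1 hxe]
        exact ih x hx
  intro x hx
  rw [reduced, Real.mul_iSup_of_nonneg ht]
  exact ciSup_le fun n => hseq n x hx

variable [LocallyCompactSpace X] [SecondCountableTopology X]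

lemma IsRecurrentBase.integral_reduced_le (he : IsRecurrentBase 𝒱 W e)
    (hH : IsNormalHarmonicFamily 𝒱 H) (hW : IsPSet 𝒱 H W) (hφ : Continuous φ)
    (h01 : ∀ x, φ x ∈ Icc (0 : ℝ) 1) (hU : U ∈ inside 𝒱 W) (hy : y ∈ U) :
    ∫ z, reduced H e φ z ∂(H U y) ≤ reduced H e φ y := by
  have := hH.isMarkovKernel hU.1
  have he𝒱 n := (he.mem_inside n).1
  have husc : UpperSemicontinuous (-reduced H e φ) :=
    continuous_neg.comp_lowerSemicontinuous_antitone (lowerSemicontinuous_reduced hH he𝒱 hφ h01)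
      fun _ _ => neg_le_neg
  refine le_of_tendsto' (tendsto_integral_reduceSeq hH he𝒱 hφ h01 (H U y)) fun n => ?_
  have hcomp : (-reduced H e φ) y ≤ ∫ z, -reduceSeq H e φ n z ∂(H U y) :=
    hW.le_integral_of_isSubmeanAt hH hU (isBoundedBorel_reduced hH he𝒱 hφ h01).neg
      (husc.upperSemicontinuousOn _)
      (fun z hz => he.isSubmeanAt_neg_reduced hH hφ h01 (hU.2 (subset_closure hz)))
      (isBoundedBorel_reduceSeq hH he𝒱 hφ h01 n).neg
      (continuous_reduceSeq hH he𝒱 hφ n).neg.continuousOn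
      (fun z _ => neg_le_neg (reduceSeq_le_reduced hH he𝒱 hφ h01 n z)) y hy
  rwa [integral_neg, Pi.neg_apply, neg_le_neg_iff] at hcomp

lemma IsRecurrentBase.isBoundedSupermean_reduced (he : IsRecurrentBase 𝒱 W e)
    (hH : IsNormalHarmonicFamily 𝒱 H) (hW : IsPSet 𝒱 H W) (hφ : Continuous φ)
    (h01 : ∀ x, φ x ∈ Icc (0 : ℝ) 1) : IsBoundedSupermean 𝒱 H W (reduced H e φ) where
  lowerSemicontinuousOn := (lowerSemicontinuous_reduced hH
    (fun n => (he.mem_inside n).1) hφ h01).lowerSemicontinuousOn W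
  isBoundedBorel := isBoundedBorel_reduced hH (fun n => (he.mem_inside n).1) hφ h01
  nonneg x := (reduced_mem_Icc hH (fun n => (he.mem_inside n).1) hφ h01 x).1
  integral_le _ hU _ hx := he.integral_reduced_le hH hW hφ h01 hU hx

lemma IsPSet.reduceSeq_le_integral (hH : IsNormalHarmonicFamily 𝒱 H) (hW : IsPSet 𝒱 H W)
    (he : ∀ n, e n ∈ 𝒱) (hφ : Continuous φ) (h01 : ∀ x, φ x ∈ Icc (0 : ℝ) 1)
    (hφC : ∀ x ∉ C, φ x = 0) (hU : U ∈ inside 𝒱 (W \ C)) (n : ℕ) (hy : y ∈ U) :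
    reduceSeq H e φ n y ≤ ∫ z, reduceSeq H e φ n z ∂(H U y) :=
  have hb := isBoundedBorel_reduceSeq hH he hφ h01 n
  have hc := continuous_reduceSeq hH he hφ n
  hW.le_integral_of_isSubmeanAt hH ⟨hU.1, hU.2.trans sdiff_subset⟩ hb
    (hc.upperSemicontinuous.upperSemicontinuousOn _)
    (fun z hz => isSubmeanAt_reduceSeq hH he hφ h01 (hφC z (hU.2 (subset_closure hz)).2) n)
    hb hc.continuousOn (fun _ _ => le_rfl) y hy

lemma IsRecurrentBase.isHarmonic_reduced (he : IsRecurrentBase 𝒱 W e)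
    (hH : IsNormalHarmonicFamily 𝒱 H) (hW : IsPSet 𝒱 H W) (hφ : Continuous φ)
    (h01 : ∀ x, φ x ∈ Icc (0 : ℝ) 1) (hC : IsClosed C) (hφC : ∀ x ∉ C, φ x = 0) :
    IsHarmonic 𝒱 H (W \ C) (reduced H e φ) := by
  have he𝒱 n := (he.mem_inside n).1
  have hb := isBoundedBorel_reduced hH he𝒱 hφ h01
  have hmean : ∀ U ∈ inside 𝒱 (W \ C), ∀ y ∈ U,
      ∫ z, reduced H e φ z ∂(H U y) = reduced H e φ y := by
    intro U hU y hy
    have := hH.isMarkovKernel hU.1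
    refine le_antisymm (he.integral_reduced_le hH hW hφ h01 ⟨hU.1, hU.2.trans sdiff_subset⟩ hy)
      (ciSup_le fun n => ?_)
    exact (hW.reduceSeq_le_integral hH he𝒱 hφ h01 hφC hU n hy).trans
      (integral_mono ((isBoundedBorel_reduceSeq hH he𝒱 hφ h01 n).integrable _) (hb.integrable _)
        (reduceSeq_le_reduced hH he𝒱 hφ h01 n))
  refine ⟨fun y hy => ContinuousAt.continuousWithinAt ?_, hmean⟩
  obtain ⟨U, hU, hyU, hUW⟩ := hH.isBasis.exists_closure_subset ((hW.1.sdiff hC).mem_nhds hy)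
  have hUy := (hH.isOpen hU).mem_nhds hyU
  exact ((hH.continuousOn_apply U hU _ hb).continuousAt hUy).congr
    (eventually_of_mem hUy fun z hz => hmean U ⟨hU, hUW⟩ z hz)

end Reduced

section Potential

variable {X : Type*} [TopologicalSpace X] [MeasurableSpace X] [BorelSpace X] [T2Space X]
  {𝒱 : Set (Set X)} {H : Set X → Kernel X X} {C G V W : Set X} {e : ℕ → Set X}
  {f g φ : X → ℝ} {x : X}

lemma IsBoundedSupermean.sub_integral (hH : IsNormalHarmonicFamily 𝒱 H)
    (hf : IsBoundedSupermean 𝒱 H W f) (hV : V ∈ inside 𝒱 W) :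
    IsBoundedSupermean 𝒱 H V fun x => f x - ∫ y, f y ∂(H V x) := by
  have := hH.isMarkovKernel hV.1
  have hb := hf.isBoundedBorel
  have hVW : V ⊆ W := subset_closure.trans hV.2
  refine ⟨?_, hb.sub (hb.integral_kernel _), fun x => ?_, fun U hU x hx => ?_⟩
  · simp only [sub_eq_add_neg]
    exact (hf.lowerSemicontinuousOn.mono hVW).add
      (hH.continuousOn_apply V hV.1 f hb).neg.lowerSemicontinuousOn
  · by_cases hx : x ∈ V
    · exact sub_nonneg.2 (hf.integral_le V hV x hx)
    · exact sub_nonneg.2 (hH.integral_of_notMem hV.1 hx f).le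
  · have := hH.isMarkovKernel hU.1
    rw [integral_sub (hb.integrable _) ((hb.integral_kernel _).integrable _),
      hH.integral_integral hU.1 hV.1 (subset_closure.trans hU.2) hb]
    exact sub_le_sub_right (hf.integral_le U ⟨hU.1, hU.2.trans hVW⟩ x hx) _

variable [LocallyCompactSpace X] [SecondCountableTopology X]

lemma IsPSet.eq_of_isBoundedSupermean_of_forall_le (hH : IsNormalHarmonicFamily 𝒱 H)
    (hell : IsElliptic 𝒱 H) (hW : IsPSet 𝒱 H W) (hf : IsBoundedSupermean 𝒱 H W f)
    (hG : IsPreconnected G) (hGo : IsOpen G) (hGW : G ⊆ W) (hx : x ∈ G)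
    (hmin : ∀ y ∈ G, f x ≤ f y) : ∀ y ∈ G, f y = f x := by
  have husc : UpperSemicontinuousOn (-f) G :=
    continuous_neg.comp_lowerSemicontinuousOn_antitone (hf.lowerSemicontinuousOn.mono hGW)
      fun _ _ => neg_le_neg
  have hsub : ∀ y ∈ G, IsSubmeanAt 𝒱 H (-f) y := by
    intro y hy O hO
    obtain ⟨U, hU, hyU, hUO⟩ := hH.isBasis.exists_closure_subset
      (inter_mem hO (hW.1.mem_nhds (hGW hy)))
    refine ⟨U, hU, hyU, hUO.trans inter_subset_left, ?_⟩
    simp only [Pi.neg_apply]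
    rw [integral_neg, neg_le_neg_iff]
    exact hf.integral_le U ⟨hU, hUO.trans inter_subset_right⟩ y hyU
  exact fun y hy => neg_injective (hW.eq_of_isSubmeanAt_of_forall_le hH hell hG hGo hGW
    hf.isBoundedBorel.neg husc hsub hx (fun z hz => neg_le_neg (hmin z hz)) y hy)

lemma IsPSet.eq_of_isHarmonic_nhds_of_forall_le (hH : IsNormalHarmonicFamily 𝒱 H)
    (hell : IsElliptic 𝒱 H) (hW : IsPSet 𝒱 H W) (hWc : IsPreconnected W) (hg : IsBoundedBorel g)
    (hloc : ∀ y ∈ W, ∃ U ∈ 𝓝 y, IsHarmonic 𝒱 H U g) (hx : x ∈ W) (hmax : ∀ y ∈ W, g y ≤ g x) :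
    ∀ y ∈ W, g y = g x := by
  have hcont : ContinuousOn g W := fun y hy =>
    let ⟨U, hU, hgU⟩ := hloc y hy
    (hgU.1.continuousAt hU).continuousWithinAt
  exact hW.eq_of_isSubmeanAt_of_forall_le hH hell hWc hW.1 Subset.rfl hg
    hcont.upperSemicontinuousOn
    (fun y hy => let ⟨U, hU, hgU⟩ := hloc y hy; hgU.isSubmeanAt hH hU) hx hmax

/-- If the reduced function were constant, every bounded supermean function would attain its
minimum over `W` in `C`. -/
lemma IsPSet.exists_reduced_ne_one (hH : IsNormalHarmonicFamily 𝒱 H) (hell : IsElliptic 𝒱 H)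
    (hW : IsPSet 𝒱 H W) (hWc : IsPreconnected W) (he : ∀ n, e n ∈ inside 𝒱 W)
    (hφ : Continuous φ) (h01 : ∀ x, φ x ∈ Icc (0 : ℝ) 1) (hC : IsCompact C) (hCne : C.Nonempty)
    (hCW : C ⊆ W) (hφC : ∀ x ∉ C, φ x = 0) : ∃ y ∈ W, reduced H e φ y ≠ 1 := by
  by_contra! hone
  obtain ⟨x, hxC⟩ := hCne
  obtain ⟨y, hy, hyx⟩ : ∃ y ∈ W, y ≠ x := by
    by_contra! hsub
    exact hH.not_isOpen_singleton x (eq_singleton_iff_unique_mem.2 ⟨hCW hxC, hsub⟩ ▸ hW.1)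
  obtain ⟨f, hf, hfne⟩ := hW.exists_isBoundedSupermean hH hy (hCW hxC) hyx
  obtain ⟨a, haC, hamin⟩ := (hf.lowerSemicontinuousOn.mono hCW).exists_isMinOn ⟨x, hxC⟩ hC
  have hmaj : ∀ z ∈ W, f a * φ z ≤ f z := by
    intro z _
    by_cases hzC : z ∈ C
    · exact (mul_le_of_le_one_right (hf.nonneg a) (h01 z).2).trans (isMinOn_iff.1 hamin z hzC)
    · rw [hφC z hzC, mul_zero]
      exact hf.nonneg z
  have hmin : ∀ z ∈ W, f a ≤ f z := fun z hz => by
    simpa only [hone z hz, mul_one] using mul_reduced_le hH he hφ h01 hf (hf.nonneg a) hmaj z hz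
  have hconst := hW.eq_of_isBoundedSupermean_of_forall_le hH hell hf hWc hW.1 Subset.rfl
    (hCW haC) hmin
  exact hfne ((hconst y hy).trans (hconst x (hCW hxC)).symm)

lemma IsRecurrentBase.integral_reduced_lt (he : IsRecurrentBase 𝒱 W e)
    (hH : IsNormalHarmonicFamily 𝒱 H) (hell : IsElliptic 𝒱 H) (hW : IsPSet 𝒱 H W)
    (hWc : IsPreconnected W) (hV : V ∈ inside 𝒱 W) (hG : IsPreconnected G) (hGo : IsOpen G)
    (hGV : G ⊆ V) (hC : IsCompact C) (hCG : C ⊆ G) (hφ : Continuous φ)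
    (h01 : ∀ x, φ x ∈ Icc (0 : ℝ) 1) (hφC : ∀ x ∉ C, φ x = 0) (hφx : φ x = 1) :
    ∀ y ∈ G, ∫ z, reduced H e φ z ∂(H V y) < reduced H e φ y := by
  have he𝒱 n := (he.mem_inside n).1
  have hb := isBoundedBorel_reduced hH he𝒱 hφ h01
  have hGW : G ⊆ W := hGV.trans (subset_closure.trans hV.2)
  have hpot := (he.isBoundedSupermean_reduced hH hW hφ h01).sub_integral hH hV
  have hxC : x ∈ C := by
    by_contra hxC
    exact zero_ne_one ((hφC x hxC).symm.trans hφx)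
  by_contra! hle
  obtain ⟨y, hyG, hy⟩ := hle
  have hG0 : ∀ z ∈ G, reduced H e φ z - ∫ z', reduced H e φ z' ∂(H V z) =
      reduced H e φ y - ∫ z', reduced H e φ z' ∂(H V y) :=
    (hW.mono (hH.isOpen hV.1) (subset_closure.trans hV.2)).eq_of_isBoundedSupermean_of_forall_le
      hH hell hpot hG hGo hGV hyG fun z _ => (sub_nonpos.2 hy).trans (hpot.nonneg z)
  have hGharm : IsHarmonic 𝒱 H G (reduced H e φ) :=
    ((hH.isHarmonic_integral hV.1 hb).mono hGV).congr hH fun z hz =>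
      sub_eq_zero.1 ((hG0 z hz).trans (le_antisymm (sub_nonpos.2 hy) (hpot.nonneg y)))
  have hloc : ∀ z ∈ W, ∃ U ∈ 𝓝 z, IsHarmonic 𝒱 H U (reduced H e φ) := by
    intro z hz
    by_cases hzC : z ∈ C
    · exact ⟨G, hGo.mem_nhds (hCG hzC), hGharm⟩
    · exact ⟨W \ C, (hW.1.sdiff hC.isClosed).mem_nhds ⟨hz, hzC⟩,
        he.isHarmonic_reduced hH hW hφ h01 hC.isClosed hφC⟩
  have hx1 : reduced H e φ x = 1 := le_antisymm (reduced_mem_Icc hH he𝒱 hφ h01 x).2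
    (hφx.ge.trans (reduceSeq_le_reduced hH he𝒱 hφ h01 0 x))
  obtain ⟨z, hz, hz1⟩ := hW.exists_reduced_ne_one hH hell hWc he.mem_inside hφ h01 hC ⟨x, hxC⟩
    (hCG.trans hGW) hφC
  exact hz1 ((hW.eq_of_isHarmonic_nhds_of_forall_le hH hell hWc hb hloc (hGW (hCG hxC))
    (fun z _ => hx1 ▸ (reduced_mem_Icc hH he𝒱 hφ h01 z).2) z hz).trans hx1)

end Potential

section StronglyStable

lemma isHarmonic_const {X : Type*} [TopologicalSpace X] [MeasurableSpace X] {𝒱 : Set (Set X)}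
    {H : Set X → Kernel X X} (hH : IsNormalHarmonicFamily 𝒱 H) (U : Set X) (c : ℝ) :
    IsHarmonic 𝒱 H U fun _ => c :=
  ⟨continuousOn_const, fun V hV x _ => have := hH.isMarkovKernel hV.1; by simp⟩

section Superlevel

lemma setOf_le_subset {X : Type*} {V : Set X} {c : ℝ} {p : X → ℝ} (hp0 : ∀ y ∉ V, p y = 0)
    (hc : 0 < c) : {y | c ≤ p y} ⊆ V :=
  fun y (hy : c ≤ p y) => by_contra fun hyV => (hp0 y hyV ▸ hy).not_gt hc

variable {X : Type*} [TopologicalSpace X] {C V : Set X} {c : ℝ} {p : X → ℝ}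

lemma subset_interior_setOf_le (hV : IsOpen V) (hCV : C ⊆ V) (hplsc : LowerSemicontinuousOn p V)
    (hcC : ∀ y ∈ C, c < p y) : C ⊆ interior {y | c ≤ p y} := by
  intro y hy
  have hev := hplsc y (hCV hy) c (hcC y hy)
  rw [hV.nhdsWithin_eq (hCV hy)] at hev
  exact mem_interior_iff_mem_nhds.2 (hev.mono fun z hz => hz.le)

lemma continuousOn_compl_of_eq_zero (hV : IsOpen V) (hC : IsClosed C)
    (hpV : ContinuousOn p (closure V \ C)) (hp0 : ∀ y ∉ V, p y = 0) : ContinuousOn p Cᶜ := by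
  intro y hy
  have hclosure : ContinuousWithinAt p (closure V) y := by
    by_cases hyV : y ∈ closure V
    · exact (hpV y ⟨hyV, hy⟩).mono_of_mem_nhdsWithin
        (inter_mem_nhdsWithin _ (hC.isOpen_compl.mem_nhds hy))
    · exact continuousWithinAt_of_notMem_closure (by rwa [closure_closure])
  have hcompl : ContinuousWithinAt p Vᶜ y := by
    by_cases hyV : y ∈ Vᶜ
    · exact continuousWithinAt_const.congr hp0 (hp0 y hyV)
    · exact continuousWithinAt_of_notMem_closure (by rwa [hV.isClosed_compl.closure_eq])
  refine (hclosure.union hcompl).mono fun z _ => ?_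
  exact (em (z ∈ V)).imp (fun h => subset_closure h) id

end Superlevel

variable {X : Type*} [TopologicalSpace X] [MeasurableSpace X] [BorelSpace X] [T2Space X]
  {𝒱 : Set (Set X)} {H : Set X → Kernel X X} {C N U V W : Set X} {c : ℝ} {h p φ : X → ℝ}
  {e : ℕ → Set X} {x z : X}

lemma IsHarmonic.integrable (hH : IsNormalHarmonicFamily 𝒱 H) (hh : IsHarmonic 𝒱 H U h)
    (hV : V ∈ inside 𝒱 U) (hx : x ∈ V) : Integrable h (H V x) := by
  have := hH.isMarkovKernel hV.1
  have hfr : IsCompact (frontier V) :=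
    (hH.isCompact_closure V hV.1).of_isClosed_subset isClosed_frontier frontier_subset_closure
  have hint : IntegrableOn h (frontier V) (H V x) :=
    (hh.1.mono (frontier_subset_closure.trans hV.2)).integrableOn_compact hfr
  rwa [IntegrableOn, Measure.restrict_eq_self_of_ae_mem (hH.ae_mem_frontier hV.1 hx)] at hint

lemma IsHarmonic.sub (hH : IsNormalHarmonicFamily 𝒱 H) (hh : IsHarmonic 𝒱 H U h)
    (hp : IsHarmonic 𝒱 H U p) : IsHarmonic 𝒱 H U fun x => h x - p x := by
  refine ⟨hh.1.sub hp.1, fun V hV x hx => ?_⟩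
  rw [integral_sub (hh.integrable hH hV hx) (hp.integrable hH hV hx), hh.2 V hV x hx,
    hp.2 V hV x hx]

lemma IsPSet.isStronglyStable_setOf_le (hH : IsNormalHarmonicFamily 𝒱 H) (hV : IsPSet 𝒱 H V)
    (hVc : IsCompact (closure V)) (hC : IsClosed C) (hCne : C.Nonempty)
    (hplsc : LowerSemicontinuousOn p V) (hpc : ContinuousOn p Cᶜ) (hp0 : ∀ y ∉ V, p y = 0)
    (hph : IsHarmonic 𝒱 H (V \ C) p) (hc : 0 < c) (hcC : ∀ y ∈ C, c < p y) :
    IsStronglyStable 𝒱 H {y | c ≤ p y} := by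
  have hNV : {y | c ≤ p y} ⊆ V := setOf_le_subset hp0 hc
  have hCN : C ⊆ {y | c ≤ p y} := fun y hy => (hcC y hy).le
  have hcont : ∀ y ∉ C, ContinuousAt p y := fun y hy =>
    hpc.continuousAt (hC.isOpen_compl.mem_nhds hy)
  have hclosed : IsClosed {y | c ≤ p y} := by
    refine isOpen_compl_iff.1 (isOpen_iff_mem_nhds.2 fun y hy => ?_)
    filter_upwards [(hcont y fun hyC => hy (hCN hyC)).eventually (gt_mem_nhds (not_le.1 hy))]
      with z hz using not_le.2 hz
  refine ⟨hVc.of_isClosed_subset hclosed (hNV.trans subset_closure), hCne.mono hCN, V, hV, hNV,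
    fun y => c - p y, (isHarmonic_const hH _ c).sub hH (hph.mono (sdiff_subset_sdiff_right hCN)),
    fun y hy => sub_pos.2 (not_le.1 hy.2), fun z hz => ?_⟩
  have hzC : z ∉ C := fun hzC =>
    hz.2 (subset_interior_setOf_le hV.1 (hCN.trans hNV) hplsc hcC hzC)
  have hpz : p z = c := by
    refine le_antisymm (not_lt.1 fun hlt => hz.2 (mem_interior_iff_mem_nhds.2 ?_))
      (hclosed.frontier_subset hz)
    exact ((hcont z hzC).eventually (lt_mem_nhds hlt)).mono fun y hy => hy.le
  simpa [hpz] using ((hcont z hzC).tendsto.mono_left nhdsWithin_le_nhds).const_sub c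

variable [LocallyCompactSpace X] [SecondCountableTopology X]

lemma IsRecurrentBase.continuousOn_reduced_sub_integral (he : IsRecurrentBase 𝒱 W e)
    (hH : IsNormalHarmonicFamily 𝒱 H) (hW : IsPSet 𝒱 H W) (hφ : Continuous φ)
    (h01 : ∀ x, φ x ∈ Icc (0 : ℝ) 1) (hC : IsClosed C) (hφC : ∀ x ∉ C, φ x = 0)
    (hV : V ∈ inside 𝒱 W) (hCV : C ⊆ V) :
    ContinuousOn (fun y => reduced H e φ y - ∫ z, reduced H e φ z ∂(H V y)) Cᶜ := by
  have hVo := hH.isOpen hV.1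
  have hw : ContinuousOn (reduced H e φ) (W \ C) :=
    (he.isHarmonic_reduced hH hW hφ h01 hC hφC).1
  have hfr : frontier V ⊆ W \ C := fun z hz =>
    ⟨hV.2 hz.1, fun hzC => (hVo.frontier_eq ▸ hz).2 (hCV hzC)⟩
  exact continuousOn_compl_of_eq_zero hVo hC
    ((hw.mono (sdiff_subset_sdiff_left hV.2)).sub
      ((hH.continuousOn_closure_integral hV.1 (hw.mono hfr)).mono sdiff_subset))
    fun y hy => sub_eq_zero.2 (hH.integral_of_notMem hV.1 hy _).symm

lemma IsPSet.exists_isStronglyStable_of_isPreconnected (hH : IsNormalHarmonicFamily 𝒱 H)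
    (hell : IsElliptic 𝒱 H) (hW : IsPSet 𝒱 H W) (hWc : IsPreconnected W) (hx : x ∈ W) :
    ∃ N, IsStronglyStable 𝒱 H N ∧ N ∈ 𝓝 x ∧ N ⊆ W := by
  obtain ⟨V, hV, hxV, hVW⟩ := hH.isBasis.exists_closure_subset (hW.1.mem_nhds hx)
  have hVo := hH.isOpen hV
  have hVW' : V ⊆ W := subset_closure.trans hVW
  have hGV : connectedComponentIn V x ⊆ V := connectedComponentIn_subset V x
  have hGo : IsOpen (connectedComponentIn V x) := hW.isOpen_connectedComponentIn hH hVo hVW' x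
  obtain ⟨C, hC, hxC, hCG⟩ := exists_compact_subset hGo (mem_connectedComponentIn hxV)
  obtain ⟨φ, hφ0, hφ1, hφ⟩ := exists_continuous_zero_one_of_isClosed
    isOpen_interior.isClosed_compl (isClosed_singleton (x := x))
    (disjoint_singleton_right.2 fun h => h hxC)
  have hφC : ∀ y ∉ C, φ y = 0 := fun y hy => hφ0 fun h => hy (interior_subset h)
  obtain ⟨e, he⟩ := hH.exists_isRecurrentBase hW.1 ⟨x, hx⟩
  set p : X → ℝ := fun y => reduced H e φ y - ∫ z, reduced H e φ z ∂(H V y)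
  have hw := he.isBoundedSupermean_reduced hH hW φ.continuous hφ
  have hplsc : LowerSemicontinuousOn p V := (hw.sub_integral hH ⟨hV, hVW⟩).lowerSemicontinuousOn
  have hpos : ∀ y ∈ connectedComponentIn V x, 0 < p y := fun y hy =>
    sub_pos.2 (he.integral_reduced_lt hH hell hW hWc ⟨hV, hVW⟩ isPreconnected_connectedComponentIn
      hGo hGV hC hCG φ.continuous hφ hφC (hφ1 rfl) y hy)
  have hp0 : ∀ y ∉ V, p y = 0 := fun y hy => sub_eq_zero.2 (hH.integral_of_notMem hV hy _).symm
  have hpharm : IsHarmonic 𝒱 H (V \ C) p :=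
    ((he.isHarmonic_reduced hH hW φ.continuous hφ hC.isClosed hφC).mono
      (sdiff_subset_sdiff_left hVW')).sub hH
      ((hH.isHarmonic_integral hV hw.isBoundedBorel).mono sdiff_subset)
  obtain ⟨a, haC, hamin⟩ := (hplsc.mono (hCG.trans hGV)).exists_isMinOn
    ⟨x, interior_subset hxC⟩ hC
  obtain ⟨c, hc, hca⟩ := exists_between (hpos a (hCG haC))
  have hcC : ∀ y ∈ C, c < p y := fun y hy => hca.trans_le (isMinOn_iff.1 hamin y hy)
  exact ⟨{y | c ≤ p y}, (hW.mono hVo hVW').isStronglyStable_setOf_le hH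
      (hH.isCompact_closure V hV) hC.isClosed ⟨x, interior_subset hxC⟩ hplsc
      (he.continuousOn_reduced_sub_integral hH hW φ.continuous hφ hC.isClosed hφC ⟨hV, hVW⟩
        (hCG.trans hGV)) hp0 hpharm hc hcC,
    mem_interior_iff_mem_nhds.1 (subset_interior_setOf_le hVo (hCG.trans hGV) hplsc hcC
      (interior_subset hxC)),
    (setOf_le_subset hp0 hc).trans hVW'⟩

lemma IsPSet.exists_isStronglyStable (hH : IsNormalHarmonicFamily 𝒱 H) (hell : IsElliptic 𝒱 H)
    (hW : IsPSet 𝒱 H W) (hx : x ∈ W) :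
    ∃ N, IsStronglyStable 𝒱 H N ∧ N ∈ 𝓝 x ∧ N ⊆ W := by
  have hsub : connectedComponentIn W x ⊆ W := connectedComponentIn_subset W x
  obtain ⟨N, hN, hNx, hNW⟩ :=
    (hW.mono (hW.isOpen_connectedComponentIn hH hW.1 Subset.rfl x)
      hsub).exists_isStronglyStable_of_isPreconnected hH hell isPreconnected_connectedComponentIn
        (mem_connectedComponentIn hx)
  exact ⟨N, hN, hNx, hNW.trans hsub⟩

end StronglyStable

section Stable

lemma eintegral_coe_eq_integral {X : Type*} [MeasurableSpace X] {μ : Measure X} {h : X → ℝ}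
    (hh : Integrable h μ) : eintegral μ (fun x => (h x : EReal)) = ((∫ y, h y ∂μ : ℝ) : EReal) := by
  have hneg : ∫⁻ y, ENNReal.ofReal (-h y) ∂μ ≠ ⊤ := hh.neg.lintegral_lt_top.ne
  rw [integral_eq_lintegral_pos_part_sub_lintegral_neg_part hh, EReal.coe_sub,
    EReal.coe_ennreal_toReal hh.lintegral_lt_top.ne, EReal.coe_ennreal_toReal hneg]
  simp only [eintegral, ← EReal.coe_neg, EReal.toENNReal_of_ne_top (EReal.coe_ne_top _),
    EReal.toReal_coe]

variable {X : Type*} [TopologicalSpace X] [T2Space X] [MeasurableSpace X] [BorelSpace X]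
  {𝒱 : Set (Set X)} {H : Set X → Kernel X X} {U W : Set X} {h : X → ℝ}

lemma IsHarmonic.isSuperharmonic (hH : IsNormalHarmonicFamily 𝒱 H) (hh : IsHarmonic 𝒱 H U h)
    (hU : IsOpen U) : IsSuperharmonic 𝒱 H U (fun x => (h x : EReal)) := by
  have heq : ∀ V ∈ inside 𝒱 U, ∀ x ∈ V, eintegral (H V x) (fun x => (h x : EReal)) = h x :=
    fun V hV x hx => by rw [eintegral_coe_eq_integral (hh.integrable hH hV hx), hh.2 V hV x hx]
  refine ⟨⟨(continuous_coe_real_ereal.comp_continuousOn hh.1).lowerSemicontinuousOn,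
    fun x _ => EReal.coe_ne_bot _, fun x _ V hV => (heq V hV.1 x hV.2).le⟩, fun V hV x hx => ?_⟩
  have hcont : ContinuousAt (fun y => |h y|) x :=
    (hh.1.continuousAt (hU.mem_nhds (hV.2 (subset_closure hx)))).abs
  refine ⟨|h x| + 1, ?_⟩
  filter_upwards [self_mem_nhdsWithin,
    nhdsWithin_le_nhds (hcont.eventually (gt_mem_nhds (lt_add_one |h x|)))] with y hy hlt
  rw [heq V hV y hy, EReal.coe_le_coe_iff, EReal.coe_le_coe_iff]
  exact abs_le.1 hlt.le

lemma IsStable.biUnion_of_isStronglyStable {ι : Type*} (hH : IsNormalHarmonicFamily 𝒱 H)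
    (hW : IsPSet 𝒱 H W) (t : Finset ι) {N : ι → Set X}
    (hN : ∀ i ∈ t, IsStronglyStable 𝒱 H (N i)) (hNW : ∀ i ∈ t, N i ⊆ W) :
    IsStable 𝒱 H (⋃ i ∈ t, N i) := by
  have hK : IsCompact (⋃ i ∈ t, N i) := t.isCompact_biUnion fun i hi => (hN i hi).1
  refine ⟨hK, ⟨W, hW, iUnion₂_subset hNW⟩, fun z hz => ?_⟩
  obtain ⟨i, hi, hzi⟩ := mem_iUnion₂.1 (hK.isClosed.frontier_subset hz)
  obtain ⟨-, -, W', hW', hNW', h, hh, hpos, hlim⟩ := hN i hi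
  have hNK : N i ⊆ ⋃ i ∈ t, N i := subset_biUnion_of_mem (u := N) hi
  have hsub : W' \ (⋃ i ∈ t, N i) ⊆ W' \ N i := sdiff_subset_sdiff_right hNK
  have hzN : z ∈ frontier (N i) := ⟨subset_closure hzi, fun hint => hz.2 (interior_mono hNK hint)⟩
  exact ⟨W', hW'.1, hNW' hzi, fun y => (h y : EReal),
    (hh.mono hsub).isSuperharmonic hH (hW'.1.sdiff hK.isClosed),
    fun y hy => EReal.coe_pos.2 (hpos y (hsub hy)),
    (continuous_coe_real_ereal.tendsto 0).comp
      ((hlim z hzN).mono_left (nhdsWithin_mono z hsub))⟩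

end Stable

end BauerFamily

theorem proposition5p2_general {X : Type*} [TopologicalSpace X] [T2Space X] [LocallyCompactSpace X]
    [SecondCountableTopology X] [MeasurableSpace X] [BorelSpace X]
    (𝒱 : Set (Set X)) (H : Set X → Kernel X X)
    (hH : BauerFamily.IsNormalHarmonicFamily 𝒱 H) (hell : BauerFamily.IsElliptic 𝒱 H)
    (W : Set X) (hW : BauerFamily.IsPSet 𝒱 H W)
    (L : Set X) (hL : IsCompact L) (hLW : L ⊆ W) :
    ∃ K : Set X, BauerFamily.IsStable 𝒱 H K ∧ L ⊆ interior K ∧ K ⊆ W ∧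
      ∃ (t : Finset X) (N : X → Set X), (∀ x ∈ t, x ∈ L) ∧
        (∀ x ∈ t, BauerFamily.IsStronglyStable 𝒱 H (N x) ∧ N x ∈ 𝓝 x ∧ N x ⊆ W) ∧
        K = ⋃ x ∈ t, N x := by
  choose! N hN hNx hNW using fun x (hx : x ∈ L) => hW.exists_isStronglyStable hH hell (hLW hx)
  obtain ⟨t, htL, hLt⟩ := hL.elim_nhds_subcover (fun x => interior (N x))
    fun x hx => interior_mem_nhds.2 (hNx x hx)
  refine ⟨⋃ x ∈ t, N x, .biUnion_of_isStronglyStable hH hW t (fun x hx => hN x (htL x hx))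
      fun x hx => hNW x (htL x hx),
    hLt.trans (iUnion₂_subset fun x hx => interior_mono (subset_biUnion_of_mem (u := N) hx)),
    iUnion₂_subset fun x hx => hNW x (htL x hx), t, N, htL,
    fun x hx => ⟨hN x (htL x hx), hNx x (htL x hx), hNW x (htL x hx)⟩, rfl⟩

theorem proposition5p2 {X : Type*} [TopologicalSpace X] [T2Space X] [LocallyCompactSpace X]
    [SecondCountableTopology X] [MeasurableSpace X] [BorelSpace X]
    (𝒱 : Set (Set X)) (H : Set X → Kernel X X)
    (hH : BauerFamily.IsNormalBauerFamily 𝒱 H) (hell : BauerFamily.IsElliptic 𝒱 H)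
    (W : Set X) (hW : BauerFamily.IsPSet 𝒱 H W)
    (L : Set X) (hL : IsCompact L) (hLW : L ⊆ W) :
    ∃ K : Set X, BauerFamily.IsStable 𝒱 H K ∧ L ⊆ interior K ∧ K ⊆ W ∧
      ∃ (t : Finset X) (N : X → Set X), (∀ x ∈ t, x ∈ L) ∧
        (∀ x ∈ t, BauerFamily.IsStronglyStable 𝒱 H (N x) ∧ N x ∈ 𝓝 x ∧ N x ⊆ W) ∧
        K = ⋃ x ∈ t, N x :=
  proposition5p2_general 𝒱 H hH.isNormalHarmonicFamily hell W hW L hL hLW
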